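/- Fix integers $n,N,M\ge 1$. Let $d\mu=\mu(x)\,dx$ be a locally finite doubling measure on $\mathbf R^n$: there is $C_1<\infty$ with $\mu(2Q)\le C_1\mu(Q)$ for all (axis-parallel) cubes $Q\subset\mathbf R^n$, where $2Q$ is the concentric cube with twice the sidelength. Let $W:\mathbf R^n\to\mathcal L(\mathbf R^N)$ be a measurable matrix function such that $W(x)$ is (symmetric) positive definite for almost every $x$, such that $W^2$ and $\ln\det W^2$ are $\mu$-integrable on every cube, and such that for some $C_2<\infty$ and all cubes $Q\subset\mathbf R^n$ $$\det\Big(\frac1{\mu(Q)}\int_Q W^2\,d\mu\Big)\le C_2^2\exp\Big(\frac1{\mu(Q)}\int_Q\ln(\det W^2)\,d\mu\Big).$$ Let $\mathcal D$ be the set of standard half-open dyadic cubes $Q=2^k(m+[0,1)^n)$, $k\in\mathbf Z$, $m\in\mathbf Z^n$, with sidelength $\ell(Q)=2^k$. For $Q\in\mathcal D$ put $$E_Qf:=\Big(\int_Q W\,d\mu\Big)^{-1}\int_Q Wf\,d\mu ,$$ and for $t>0$ put $E_tf(x):=E_Qf$, where $Q\in\mathcal D$ is the dyadic cube containing $x$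 with $\ell(Q)=2^k$, $2^{k-1}<t\le 2^k$. Let $\gamma:(0,\infty)\times\mathbf R^n\to\mathcal L(\mathbf R^N;\mathbf R^M)$ be measurable, and let $|\cdot|$ denote Euclidean norms of vectors and the operator norm of matrices. Suppose that there are constants $C_3,C_4<\infty$ such that for every $Q\in\mathcal D$ and every unit vector $v\in\mathbf R^N$ there is a function $b_Q^v\in L_2(\mathbf R^n,\mu;\mathbf R^N)$ with $$(v,E_Qb_Q^v)=1,\qquad \int_{\mathbf R^n}|b_Q^v|^2\,d\mu\le C_3^2\,\mu(Q),\qquad \int_0^\infty\!\!\int_{\mathbf R^n}|\gamma(t,x)E_tb_Q^v(x)|^2\,\frac{d\mu(x)\,dt}{t}\le C_4^2\,\mu(Q).$$ Then $|\gamma(t,x)|^2\,dt\,d\mu(x)/t$ is a dyadic Carleson measure: $$\sup_{Q\in\mathcal D}\frac1{\mu(Q)}\iint_{(0,\ell(Q))\times Q}|\gamma(t,x)|^2\,\frac{dt\,d\mu(x)}{t}<\infty .$$ -/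

import Mathlib

open MeasureTheory
open scoped ENNReal NNReal

noncomputable section

namespace LocalTb

/-- The (half-open, axis-parallel) cube in `ℝⁿ` with centre `c` and sidelength `l`. -/
def cube {n : ℕ} (c : Fin n → ℝ) (l : ℝ) : Set (Fin n → ℝ) :=
  Set.univ.pi fun i => Set.Ico (c i - l / 2) (c i + l / 2)

/-- The standard dyadic cube of sidelength `2 ^ k` with lower corner `2 ^ k m`, `m ∈ ℤⁿ`. -/
def dyadicCube {n : ℕ} (k : ℤ) (m : Fin n → ℤ) : Set (Fin n → ℝ) :=
  Set.univ.pi fun i => Set.Ico ((2 : ℝ) ^ k * (m i : ℝ)) ((2 : ℝ) ^ k * ((m i : ℝ) + 1))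

/-- `μ` is a locally finite measure `dμ = μ(x) dx` (absolute continuity with respect to Lebesgue
measure) that is doubling with constant `C`: `μ(2Q) ≤ C μ(Q)` for all cubes `Q`. -/
structure IsDoublingWith {n : ℕ} (μ : Measure (Fin n → ℝ)) (C : ℝ≥0) : Prop where
  locallyFinite : IsLocallyFiniteMeasure μ
  absolutelyContinuous : μ ≪ volume
  doubling : ∀ (c : Fin n → ℝ) (l : ℝ), 0 < l → μ (cube c (2 * l)) ≤ C * μ (cube c l)

/-- A matrix weight: a measurable matrix function, positive definite almost everywhere. -/
structure IsMatrixWeight {n N : ℕ} (μ : Measure (Fin n → ℝ))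
    (W : (Fin n → ℝ) → Matrix (Fin N) (Fin N) ℝ) : Prop where
  aemeasurable : ∀ i j, AEMeasurable (fun x => W x i j) μ
  posDef : ∀ᵐ x ∂μ, (W x).PosDef

/-- The entrywise integral of a matrix function over a set. -/
def matrixIntegral {n N : ℕ} (μ : Measure (Fin n → ℝ)) (Q : Set (Fin n → ℝ))
    (W : (Fin n → ℝ) → Matrix (Fin N) (Fin N) ℝ) : Matrix (Fin N) (Fin N) ℝ :=
  Matrix.of fun i j => ∫ x in Q, W x i j ∂μ

/-- The entrywise `μ`-average of a matrix function over a set. -/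
def matrixAverage {n N : ℕ} (μ : Measure (Fin n → ℝ)) (Q : Set (Fin n → ℝ))
    (W : (Fin n → ℝ) → Matrix (Fin N) (Fin N) ℝ) : Matrix (Fin N) (Fin N) ℝ :=
  Matrix.of fun i j => ⨍ x in Q, W x i j ∂μ

/-- The determinant `A_∞` condition with constant `K` for a matrix function `V`, over all cubes:
`det (ave_Q V) ≤ K exp (ave_Q ln det V)`. Both averages are required to be those of integrable
functions. -/
def IsMatrixAInfty {n N : ℕ} (μ : Measure (Fin n → ℝ))
    (V : (Fin n → ℝ) → Matrix (Fin N) (Fin N) ℝ) (K : ℝ) : Prop :=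
  ∀ (c : Fin n → ℝ) (l : ℝ), 0 < l →
    (∀ i j, IntegrableOn (fun x => V x i j) (cube c l) μ) ∧
    IntegrableOn (fun x => Real.log (V x).det) (cube c l) μ ∧
    (matrixAverage μ (cube c l) V).det ≤
      K * Real.exp (⨍ x in cube c l, Real.log (V x).det ∂μ)

/-- The matrix-weighted average `E_Q f = (∫_Q W dμ)⁻¹ ∫_Q W f dμ`. -/
def weightedAverage {n N : ℕ} (μ : Measure (Fin n → ℝ))
    (W : (Fin n → ℝ) → Matrix (Fin N) (Fin N) ℝ) (Q : Set (Fin n → ℝ))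
    (f : (Fin n → ℝ) → EuclideanSpace ℝ (Fin N)) : EuclideanSpace ℝ (Fin N) :=
  Matrix.toEuclideanLin (matrixIntegral μ Q W)⁻¹
    (∫ x in Q, Matrix.toEuclideanLin (W x) (f x) ∂μ)

/-- For `t > 0`, the dyadic cube of sidelength `2 ^ k` containing `x`, where
`2 ^ (k - 1) < t ≤ 2 ^ k`, that is `k = ⌈log₂ t⌉`. -/
def dyadicCubeAt {n : ℕ} (t : ℝ) (x : Fin n → ℝ) : Set (Fin n → ℝ) :=
  dyadicCube (Int.clog 2 t) fun i => ⌊x i / (2 : ℝ) ^ Int.clog 2 t⌋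

/-- The dyadic weighted averaging operator `E_t`. -/
def averagingOperator {n N : ℕ} (μ : Measure (Fin n → ℝ))
    (W : (Fin n → ℝ) → Matrix (Fin N) (Fin N) ℝ) (t : ℝ)
    (f : (Fin n → ℝ) → EuclideanSpace ℝ (Fin N)) (x : Fin n → ℝ) : EuclideanSpace ℝ (Fin N) :=
  weightedAverage μ W (dyadicCubeAt t x) f

/-- The measure `dt dμ(x) / t` on the half space `t > 0` of `ℝ × ℝⁿ`. -/
def halfSpaceMeasure {n : ℕ} (μ : Measure (Fin n → ℝ)) : Measure (ℝ × (Fin n → ℝ)) :=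
  ((volume.restrict (Set.Ioi (0 : ℝ))).withDensity fun t => ENNReal.ofReal t⁻¹).prod μ

/-- The Carleson box `(0, l(Q)) × Q` over the dyadic cube `Q` with indices `k`, `m`. -/
def carlesonBox {n : ℕ} (k : ℤ) (m : Fin n → ℤ) : Set (ℝ × (Fin n → ℝ)) :=
  Set.Ioo (0 : ℝ) ((2 : ℝ) ^ k) ×ˢ dyadicCube k m

end LocalTb

end

/-! Write `⟨·⟩_Q` for the `μ`-average over `Q`. A finite `ε`-net of unit vectors `v` splits the
operators into cones on which `|A|` is nearly attained in direction `v`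
(`exists_finite_directions`), so it suffices to treat the part of `γ` lying in one cone. If `e = E_t
b_Q^v (x)` satisfies `(v, e) ≥ 1/2` and `4ε|e| ≤ 1`, then `|γ|² ≤ 16 |γ e|²` on that cone, and the
hypothesis on `b_Q^v` controls the right side. The problem is to handle the stopping cubes below `Q`
on which this lower or upper bound for `e` fails, or on which the averages of `W` and `W²` have
moved too far from those over `Q`.

Both averages are tracked by the positive definite block matrix `P = [[2, W], [W, W²]]`, for which
`det P = det W²`. The Jensen defect `J(Q) = log det ⟨P⟩_Q - ⟨log det W²⟩_Q` is nonnegative, and is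
bounded uniformly in `Q` by Fischer's inequality and the `A_∞` condition. The relative entropy of
`⟨P⟩_{Q'}` with respect to `⟨P⟩_Q` controls the change of the quadratic forms
(`abs_quadForm_sub_le`). The `A_∞` condition also gives the reverse Hölder inequality `⟨W²⟩ ≤ K
⟨W⟩²`.

Instead of a packing estimate for stopping cubes, the proof uses the potential `μ(Q)(1 + a J(Q))`.
For a fixed root `Q`, one explicit function, `stoppingDensity`, has integral at least `μ(Q')(1 + a
J(Q'))` over each stopping cube `Q'` (`le_integral_stoppingDensity`), but at most `μ(Q)(1 + a J(Q) -
κ/4)` over the root (`integral_stoppingDensity_root_le`). Multiplied by a large `Λ`, the gain `κ/4`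
pays for the non-stopping region. Induction on the number of dyadic scales
(`stopping_time_induction`, `exists_lintegral_strip_le`) then bounds the integral over truncated
boxes independently of the truncation. -/

namespace LocalTb

/-! ### Relative eigenvalues and the log-determinant divergence -/

section LinearAlgebra

open Matrix

variable {ι : Type*} [Fintype ι] [DecidableEq ι]

lemma exists_congruence_one {S : Matrix ι ι ℝ} (hS : S.PosDef) :
    ∃ G : Matrix ι ι ℝ, Gᵀ * S * G = 1 := by
  have hU := hS.1.conjStarAlgAut_star_eigenvectorUnitary
  rw [Unitary.conjStarAlgAut_star_apply] at hU
  set U : Matrix ι ι ℝ := (hS.1.eigenvectorUnitary : Matrix ι ι ℝ) with hUdef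
  have hU' : Uᵀ * S * U = diagonal hS.1.eigenvalues := by
    have : star U = Uᵀ := by rw [star_eq_conjTranspose, conjTranspose_eq_transpose_of_trivial]
    rw [← this]; exact hU
  refine ⟨U * diagonal fun i => (√(hS.1.eigenvalues i))⁻¹, ?_⟩
  rw [transpose_mul, diagonal_transpose,
    show ∀ D : Matrix ι ι ℝ, D * Uᵀ * S * (U * D) = D * (Uᵀ * S * U) * D from
      fun D => by simp only [Matrix.mul_assoc], hU', diagonal_mul_diagonal, diagonal_mul_diagonal,
    ← diagonal_one]
  congr 1
  funext i
  have h := hS.eigenvalues_pos i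
  have h' := Real.sqrt_pos.2 h
  field_simp
  rw [Real.sq_sqrt h.le]

/-- Simultaneous diagonalization of two positive definite matrices by a congruence. -/
lemma exists_simultaneous_diagonalization {S P : Matrix ι ι ℝ} (hS : S.PosDef) (hP : P.PosDef) :
    ∃ (H : Matrix ι ι ℝ) (l : ι → ℝ), IsUnit H.det ∧ Hᵀ * S * H = 1 ∧
      Hᵀ * P * H = diagonal l ∧ ∀ i, 0 < l i := by
  obtain ⟨G, hG⟩ := exists_congruence_one hS
  have hGu : IsUnit G := by
    rw [isUnit_iff_isUnit_det]
    have := congrArg det hG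
    rw [det_mul, det_mul, det_one] at this
    exact IsUnit.of_mul_eq_one _ (by rw [mul_comm]; exact this)
  have hGP : (Gᵀ * P * G).PosDef := by
    have := hP.conjTranspose_mul_mul_same (B := G) (mulVec_injective_of_isUnit hGu)
    rwa [conjTranspose_eq_transpose_of_trivial] at this
  have hU := hGP.1.conjStarAlgAut_star_eigenvectorUnitary
  rw [Unitary.conjStarAlgAut_star_apply] at hU
  set U : Matrix ι ι ℝ := (hGP.1.eigenvectorUnitary : Matrix ι ι ℝ) with hUdef
  have hst : star U = Uᵀ := by rw [star_eq_conjTranspose, conjTranspose_eq_transpose_of_trivial]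
  have hUU : Uᵀ * U = 1 := by rw [← hst]; exact Unitary.coe_star_mul_self _
  have h1 : (G * U)ᵀ * S * (G * U) = 1 := by
    rw [transpose_mul, show Uᵀ * Gᵀ * S * (G * U) = Uᵀ * (Gᵀ * S * G) * U by
      simp only [Matrix.mul_assoc], hG, Matrix.mul_one, hUU]
  refine ⟨G * U, hGP.1.eigenvalues, ?_, h1, ?_, hGP.eigenvalues_pos⟩
  · have := congrArg det h1
    rw [det_mul, det_one] at this
    exact IsUnit.of_mul_eq_one _ (by rw [mul_comm]; exact this)
  · rw [transpose_mul, show Uᵀ * Gᵀ * P * (G * U) = Uᵀ * (Gᵀ * P * G) * U by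
      simp only [Matrix.mul_assoc], ← hst]
    exact hU

/-- The generalized eigenvalues of a positive definite matrix relative to another one. -/
lemma exists_relative_eigenvalues {S P : Matrix ι ι ℝ} (hS : S.PosDef) (hP : P.PosDef) :
    ∃ (H : Matrix ι ι ℝ) (l : ι → ℝ), (∀ i, 0 < l i) ∧ (S⁻¹ * P).trace = ∑ i, l i ∧
      P.det = S.det * ∏ i, l i ∧ (∀ x, ∃ c, x = H *ᵥ c) ∧
      (∀ c, H *ᵥ c ⬝ᵥ S *ᵥ (H *ᵥ c) = ∑ i, c i ^ 2) ∧
      (∀ c, H *ᵥ c ⬝ᵥ P *ᵥ (H *ᵥ c) = ∑ i, l i * c i ^ 2) := by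
  obtain ⟨H, l, hH, hHS, hHP, hl⟩ := exists_simultaneous_diagonalization hS hP
  have hquad : ∀ (M : Matrix ι ι ℝ) c, H *ᵥ c ⬝ᵥ M *ᵥ (H *ᵥ c) = c ⬝ᵥ (Hᵀ * M * H) *ᵥ c := by
    intro M c
    rw [dotProduct_comm, ← mulVec_mulVec, ← mulVec_mulVec, dotProduct_mulVec c, vecMul_transpose,
      dotProduct_comm]
  refine ⟨H, l, hl, ?_, ?_, fun x => ⟨H⁻¹ *ᵥ x, ?_⟩, fun c => ?_, fun c => ?_⟩
  · have : S⁻¹ = H * Hᵀ := by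
      refine inv_eq_left_inv ?_
      have h1 : (Hᵀ * S) = H⁻¹ := (inv_eq_left_inv hHS).symm
      rw [Matrix.mul_assoc, h1, mul_nonsing_inv _ hH]
    rw [this, Matrix.mul_assoc, trace_mul_comm, hHP, trace_diagonal]
  · have h1 := congrArg det hHS
    have h2 := congrArg det hHP
    simp only [det_mul, det_transpose, det_one, det_diagonal] at h1 h2
    rw [← h2]
    linear_combination (-P.det) * h1
  · rw [mulVec_mulVec, mul_nonsing_inv _ hH, one_mulVec]
  · rw [hquad, hHS, one_mulVec]
    simp [dotProduct, sq]
  · rw [hquad, hHP]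
    simp only [dotProduct, mulVec_diagonal]
    exact Finset.sum_congr rfl fun i _ => by ring

/-- This is `log √t ≤ √t - 1` rearranged. It turns a small divergence into relative eigenvalues
close to `1`. -/
lemma sq_sqrt_sub_one_le {t : ℝ} (ht : 0 < t) : (√t - 1) ^ 2 ≤ t - 1 - Real.log t := by
  have h := Real.log_le_sub_one_of_pos (Real.sqrt_pos.2 ht)
  rw [Real.log_sqrt ht.le] at h
  nlinarith [Real.sq_sqrt ht.le]

/-- The relative entropy (Bregman divergence of `-log det`) of `P` with respect to `S`. -/
noncomputable def logDetDivergence (S P : Matrix ι ι ℝ) : ℝ :=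
  (S⁻¹ * P).trace - Fintype.card ι - Real.log P.det + Real.log S.det

lemma logDetDivergence_eq_sum {S P : Matrix ι ι ℝ} (hS : S.PosDef) {l : ι → ℝ}
    (hl : ∀ i, 0 < l i) (ht : (S⁻¹ * P).trace = ∑ i, l i) (hd : P.det = S.det * ∏ i, l i) :
    logDetDivergence S P = ∑ i, (l i - 1 - Real.log (l i)) := by
  have hS0 := hS.det_pos
  rw [logDetDivergence, ht, hd, Real.log_mul hS0.ne' (Finset.prod_pos fun i _ => hl i).ne',
    Real.log_prod fun i _ => (hl i).ne', Finset.sum_sub_distrib, Finset.sum_sub_distrib]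
  simp only [Finset.sum_const, Finset.card_univ, nsmul_eq_mul, mul_one]
  ring

lemma logDetDivergence_nonneg {S P : Matrix ι ι ℝ} (hS : S.PosDef) (hP : P.PosDef) :
    0 ≤ logDetDivergence S P := by
  obtain ⟨H, l, hl, ht, hd, -⟩ := exists_relative_eigenvalues hS hP
  rw [logDetDivergence_eq_sum hS hl ht hd]
  exact Finset.sum_nonneg fun i _ => (sq_nonneg _).trans (sq_sqrt_sub_one_le (hl i))

lemma logDetDivergence_self {S : Matrix ι ι ℝ} (hS : S.PosDef) : logDetDivergence S S = 0 := by
  rw [logDetDivergence, nonsing_inv_mul _ hS.det_pos.ne'.isUnit, trace_one]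
  ring

/-- The divergence is a sum of nonnegative terms over the relative eigenvalues, so each eigenvalue
is separately close to `1`; the comparison is then read off in simultaneously diagonalizing
coordinates. -/
lemma abs_quadForm_sub_le {S P : Matrix ι ι ℝ} (hS : S.PosDef) (hP : P.PosDef) {τ : ℝ}
    (hτ : 0 ≤ τ) (hτ1 : τ ≤ 1) (h : logDetDivergence S P ≤ τ ^ 2) (x : ι → ℝ) :
    |x ⬝ᵥ P *ᵥ x - x ⬝ᵥ S *ᵥ x| ≤ 3 * τ * (x ⬝ᵥ S *ᵥ x) := by
  obtain ⟨H, l, hl, ht, hd, hsurj, hqS, hqP⟩ := exists_relative_eigenvalues hS hP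
  rw [logDetDivergence_eq_sum hS hl ht hd] at h
  -- `|l - 1| = |√l - 1| (√l + 1) ≤ τ (2 + τ) ≤ 3τ`.
  have hli : ∀ i, |l i - 1| ≤ 3 * τ := by
    intro i
    have h1 : (√(l i) - 1) ^ 2 ≤ τ ^ 2 := by
      refine (sq_sqrt_sub_one_le (hl i)).trans (le_trans ?_ h)
      exact Finset.single_le_sum (f := fun i => l i - 1 - Real.log (l i))
        (fun j _ => (sq_nonneg _).trans (sq_sqrt_sub_one_le (hl j))) (Finset.mem_univ i)
    have h2 := abs_le_of_sq_le_sq' h1 hτ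
    have h3 := Real.sq_sqrt (hl i).le
    have h4 := Real.sqrt_nonneg (l i)
    rw [abs_le]
    constructor <;> nlinarith
  obtain ⟨c, rfl⟩ := hsurj x
  rw [hqS, hqP, ← Finset.sum_sub_distrib, Finset.mul_sum]
  refine (Finset.abs_sum_le_sum_abs _ _).trans (Finset.sum_le_sum fun i _ => ?_)
  rw [show l i * c i ^ 2 - c i ^ 2 = (l i - 1) * c i ^ 2 by ring, abs_mul,
    abs_of_nonneg (sq_nonneg (c i))]
  exact mul_le_mul_of_nonneg_right (hli i) (sq_nonneg _)

/-- If `S ≤ P` and `det P ≤ K det S`, then `P ≤ K S`. -/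
lemma quadForm_le_of_det_le {S P : Matrix ι ι ℝ} (hS : S.PosDef) (hP : P.PosDef) {K : ℝ}
    (hSP : ∀ x, x ⬝ᵥ S *ᵥ x ≤ x ⬝ᵥ P *ᵥ x) (hdet : P.det ≤ K * S.det) (x : ι → ℝ) :
    x ⬝ᵥ P *ᵥ x ≤ K * (x ⬝ᵥ S *ᵥ x) := by
  obtain ⟨H, l, hl, ht, hd, hsurj, hqS, hqP⟩ := exists_relative_eigenvalues hS hP
  -- All relative eigenvalues are at least `1`, so a bound on their product bounds each of them.
  have h1 : ∀ i, 1 ≤ l i := by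
    intro i
    have := hSP (H *ᵥ Pi.single i 1)
    rw [hqS, hqP] at this
    simpa [Pi.single_apply, ite_pow] using this
  have hprod : ∏ i, l i ≤ K := by
    have h0 := hS.det_pos
    rw [hd] at hdet
    exact le_of_mul_le_mul_left (by linarith) h0
  have hK : ∀ i, l i ≤ K := by
    intro i
    refine le_trans ?_ hprod
    rw [← Finset.mul_prod_erase _ _ (Finset.mem_univ i)]
    exact le_mul_of_one_le_right (hl i).le (Finset.one_le_prod fun j _ => h1 j)
  obtain ⟨c, rfl⟩ := hsurj x
  rw [hqS, hqP, Finset.mul_sum]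
  exact Finset.sum_le_sum fun i _ => mul_le_mul_of_nonneg_right (hK i) (sq_nonneg _)

end LinearAlgebra

/-! ### Cones of operators almost extremal in a direction -/

section Cone

variable {E F : Type*} [NormedAddCommGroup E] [InnerProductSpace ℝ E]
  [NormedAddCommGroup F] [InnerProductSpace ℝ F]

/-- The operators which are almost extremal in the direction `v`. -/
def directionCone (F : Type*) [NormedAddCommGroup F] [InnerProductSpace ℝ F] (v : E) (ε : ℝ) :
    Set (E →L[ℝ] F) :=
  {A | ∀ w, ‖A‖ * (inner ℝ v w - ε * ‖w‖) ≤ ‖A w‖}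

lemma isClosed_directionCone (v : E) (ε : ℝ) : IsClosed (directionCone F v ε) := by
  simp only [directionCone, Set.ofPred_forall]
  exact isClosed_iInter fun w => isClosed_le (by fun_prop) (by fun_prop)

variable [FiniteDimensional ℝ E] [FiniteDimensional ℝ F]

/-- A maximizer `v` of `|A v|` on the unit sphere satisfies `A* A v = |A|² v`, so `|A|² (v, w) = (A
v, A w) ≤ |A| |A w|`. -/
lemma exists_extremal_direction [Nontrivial E] (A : E →L[ℝ] F) :
    ∃ v : E, ‖v‖ = 1 ∧ ∀ w, ‖A‖ * inner ℝ v w ≤ ‖A w‖ := by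
  obtain ⟨v, hv, hmax⟩ := (isCompact_sphere (0 : E) 1).exists_isMaxOn
    (NormedSpace.sphere_nonempty.2 zero_le_one) (f := fun v => ‖A v‖) (by fun_prop)
  have hv1 : ‖v‖ = 1 := by simpa using hv
  have hA : ‖A v‖ = ‖A‖ := by
    refine le_antisymm (A.unit_le_opNorm v hv1.le) (A.opNorm_le_bound (norm_nonneg _) fun w => ?_)
    rcases eq_or_ne w 0 with rfl | hw
    · simp
    have hw' : 0 < ‖w‖ := norm_pos_iff.2 hw
    have := hmax (show ‖w‖⁻¹ • w ∈ Metric.sphere (0 : E) 1 by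
      simp [norm_smul, hw'.ne'])
    simp only [Set.mem_ofPred_eq, map_smul, norm_smul, norm_inv, norm_norm] at this
    rwa [inv_mul_le_iff₀ hw', mul_comm] at this
  refine ⟨v, hv1, fun w => ?_⟩
  have hT : ContinuousLinearMap.adjoint A (A v) = ‖A‖ ^ 2 • v := by
    rw [← sub_eq_zero, ← norm_le_zero_iff]
    have h1 : ‖ContinuousLinearMap.adjoint A (A v)‖ ≤ ‖A‖ ^ 2 := by
      refine (ContinuousLinearMap.le_opNorm _ _).trans ?_
      rw [hA, sq]
      exact mul_le_mul_of_nonneg_right (by simp) (norm_nonneg _)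
    have h2 : inner ℝ (ContinuousLinearMap.adjoint A (A v)) (‖A‖ ^ 2 • v) = ‖A‖ ^ 4 := by
      rw [inner_smul_right, ContinuousLinearMap.adjoint_inner_left, real_inner_self_eq_norm_sq, hA]
      ring
    have h3 := norm_sub_sq_real (ContinuousLinearMap.adjoint A (A v)) (‖A‖ ^ 2 • v)
    rw [h2, norm_smul, hv1] at h3
    simp only [norm_pow, norm_norm, mul_one] at h3
    have h4 := pow_le_pow_left₀ (norm_nonneg _) h1 2
    -- Expanding the square gives at most `|A|⁴ - 2|A|⁴ + |A|⁴ = 0`.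
    have h5 : ‖ContinuousLinearMap.adjoint A (A v) - ‖A‖ ^ 2 • v‖ ^ 2 ≤ 0 := by nlinarith
    exact le_of_eq (pow_eq_zero_iff two_ne_zero |>.1 (le_antisymm h5 (sq_nonneg _)))
  rcases eq_or_lt_of_le (norm_nonneg A) with h0 | h0
  · rw [← h0]; simp
  have h6 : ‖A‖ ^ 2 * inner ℝ v w ≤ ‖A‖ * ‖A w‖ := by
    have : inner ℝ (A v) (A w) = ‖A‖ ^ 2 * inner ℝ v w := by
      rw [← ContinuousLinearMap.adjoint_inner_left, hT, inner_smul_left]; simp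
    rw [← this, ← hA]
    exact real_inner_le_norm _ _
  nlinarith

/-- Replacing the extremal direction of `A` by a point of an `ε`-net changes the inner product with
`z` by at most `ε|z|`, which is the slack built into the cone. -/
lemma exists_finite_directions (E F : Type*) [NormedAddCommGroup E] [InnerProductSpace ℝ E]
    [NormedAddCommGroup F] [InnerProductSpace ℝ F] [FiniteDimensional ℝ E] [FiniteDimensional ℝ F]
    [Nontrivial E] {ε : ℝ} (hε : 0 < ε) :
    ∃ s : Finset E, (∀ v ∈ s, ‖v‖ = 1) ∧ ∀ A : E →L[ℝ] F, ∃ v ∈ s, A ∈ directionCone F v ε := by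
  obtain ⟨t, hts, htf, hcov⟩ := (isCompact_sphere (0 : E) 1).finite_cover_balls hε
  refine ⟨htf.toFinset, fun v hv => by simpa using hts (htf.mem_toFinset.1 hv), fun A => ?_⟩
  obtain ⟨w, hw, hA⟩ := exists_extremal_direction A
  obtain ⟨v, hv, hwv⟩ := Set.mem_iUnion₂.1 (hcov (show w ∈ Metric.sphere (0 : E) 1 by simpa))
  refine ⟨v, htf.mem_toFinset.2 hv, fun z => le_trans ?_ (hA z)⟩
  refine mul_le_mul_of_nonneg_left ?_ (norm_nonneg _)
  have h1 : inner ℝ (v - w) z ≤ ε * ‖z‖ := by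
    refine (real_inner_le_norm _ _).trans (mul_le_mul_of_nonneg_right ?_ (norm_nonneg _))
    rw [← dist_eq_norm, dist_comm]
    exact (Metric.mem_ball.1 hwv).le
  rw [inner_sub_left] at h1
  linarith

end Cone

end LocalTb

namespace LocalTb

open Matrix

/-! ### Averages of matrix functions and Jensen's inequality -/

section Expectation

variable {α ι : Type*} [MeasurableSpace α] [Fintype ι]

/-- The entrywise expectation of a matrix function. -/
noncomputable def expectation (ρ : Measure α) (P : α → Matrix ι ι ℝ) : Matrix ι ι ℝ :=
  of fun i j => ∫ x, P x i j ∂ρ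

variable {ρ : Measure α} {P : α → Matrix ι ι ℝ}

lemma integrable_dotProduct_mulVec (hP : ∀ i j, Integrable (fun x => P x i j) ρ) (y z : ι → ℝ) :
    Integrable (fun x => y ⬝ᵥ P x *ᵥ z) ρ := by
  simp only [dotProduct, mulVec]
  exact integrable_finsetSum _ fun i _ =>
    (integrable_finsetSum _ fun j _ => (hP i j).mul_const _).const_mul _

lemma dotProduct_expectation_mulVec (hP : ∀ i j, Integrable (fun x => P x i j) ρ)
    (y z : ι → ℝ) : y ⬝ᵥ expectation ρ P *ᵥ z = ∫ x, y ⬝ᵥ P x *ᵥ z ∂ρ := by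
  simp only [dotProduct, mulVec, expectation, of_apply]
  rw [integral_finsetSum _ fun i _ =>
    (integrable_finsetSum _ fun j _ => (hP i j).mul_const _).const_mul _]
  refine Finset.sum_congr rfl fun i _ => ?_
  rw [integral_const_mul, integral_finsetSum _ fun j _ => (hP i j).mul_const _]
  simp only [integral_mul_const]

lemma trace_mul_eq_sum (S Q : Matrix ι ι ℝ) : (S * Q).trace = ∑ i, ∑ j, S i j * Q j i := by
  simp [trace, mul_apply]

lemma integrable_trace_mul (S : Matrix ι ι ℝ) (hP : ∀ i j, Integrable (fun x => P x i j) ρ) :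
    Integrable (fun x => (S * P x).trace) ρ := by
  simp only [trace_mul_eq_sum]
  exact integrable_finsetSum _ fun i _ => integrable_finsetSum _ fun j _ => (hP j i).const_mul _

lemma trace_mul_expectation (S : Matrix ι ι ℝ) (hP : ∀ i j, Integrable (fun x => P x i j) ρ) :
    (S * expectation ρ P).trace = ∫ x, (S * P x).trace ∂ρ := by
  simp only [trace_mul_eq_sum, expectation, of_apply]
  symm
  refine (integral_finsetSum _ fun i _ => integrable_finsetSum _ fun j _ =>
    (hP j i).const_mul _).trans (Finset.sum_congr rfl fun i _ => ?_)
  refine (integral_finsetSum _ fun j _ => (hP j i).const_mul _).trans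
    (Finset.sum_congr rfl fun j _ => ?_)
  exact integral_const_mul _ _

variable [IsProbabilityMeasure ρ]

lemma posDef_expectation (hP : ∀ i j, Integrable (fun x => P x i j) ρ)
    (hpos : ∀ᵐ x ∂ρ, (P x).PosDef) : (expectation ρ P).PosDef := by
  refine PosDef.of_dotProduct_mulVec_pos ?_ fun z hz => ?_
  · ext i j
    rw [conjTranspose_apply, star_trivial, expectation, of_apply, of_apply]
    refine integral_congr_ae ?_
    filter_upwards [hpos] with x hx
    simpa using (hx.1.apply i j)
  · rw [star_trivial, dotProduct_expectation_mulVec hP]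
    have hz' : ∀ᵐ x ∂ρ, 0 < z ⬝ᵥ P x *ᵥ z := by
      filter_upwards [hpos] with x hx
      simpa using hx.dotProduct_mulVec_pos hz
    refine lt_of_le_of_ne (integral_nonneg_of_ae (hz'.mono fun x hx => hx.le)) fun h0 => ?_
    have h1 := (integral_eq_zero_iff_of_nonneg_ae (hz'.mono fun x hx => hx.le)
      (integrable_dotProduct_mulVec hP z z)).1 h0.symm
    obtain ⟨x, hx, hx'⟩ := (h1.and hz').exists
    exact hx'.ne' hx

variable [DecidableEq ι]

/-- Jensen's inequality for the concave function `log det`. -/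
lemma integral_log_det_le (hP : ∀ i j, Integrable (fun x => P x i j) ρ)
    (hpos : ∀ᵐ x ∂ρ, (P x).PosDef) (hlog : Integrable (fun x => Real.log (P x).det) ρ) :
    ∫ x, Real.log (P x).det ∂ρ ≤ Real.log (expectation ρ P).det := by
  have hA := posDef_expectation hP hpos
  -- Nonnegativity of the divergence is the tangent-plane bound for `log det` at the average; the
  -- linear term integrates to the dimension.
  have h : ∫ x, Real.log (P x).det ∂ρ ≤ ∫ x, (((expectation ρ P)⁻¹ * P x).trace +
      (Real.log (expectation ρ P).det - Fintype.card ι)) ∂ρ := by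
    refine integral_mono_ae hlog ((integrable_trace_mul _ hP).add (integrable_const _)) ?_
    filter_upwards [hpos] with x hx
    have := logDetDivergence_nonneg hA hx
    rw [logDetDivergence] at this
    linarith
  rw [integral_add (integrable_trace_mul _ hP) (integrable_const _), ← trace_mul_expectation _ hP,
    nonsing_inv_mul _ hA.det_pos.ne'.isUnit, trace_one, integral_const] at h
  simpa using h

end Expectation

section Euclidean

variable {N : ℕ}

lemma inner_toEuclideanLin (A : Matrix (Fin N) (Fin N) ℝ) (v w : EuclideanSpace ℝ (Fin N)) :
    inner ℝ v (toEuclideanLin A w) = v.ofLp ⬝ᵥ A *ᵥ w.ofLp := by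
  rw [EuclideanSpace.inner_eq_star_dotProduct, star_trivial, dotProduct_comm]
  rfl

lemma inner_toEuclideanLin_comm {A : Matrix (Fin N) (Fin N) ℝ} (hA : A.IsHermitian)
    (v w : EuclideanSpace ℝ (Fin N)) :
    inner ℝ (toEuclideanLin A v) w = inner ℝ v (toEuclideanLin A w) :=
  (isSymmetric_toEuclideanLin_iff.2 hA) v w

lemma norm_toEuclideanLin_sq {A : Matrix (Fin N) (Fin N) ℝ} (hA : A.IsHermitian)
    (v : EuclideanSpace ℝ (Fin N)) :
    ‖toEuclideanLin A v‖ ^ 2 = v.ofLp ⬝ᵥ (A ^ 2) *ᵥ v.ofLp := by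
  rw [← real_inner_self_eq_norm_sq, inner_toEuclideanLin_comm hA, inner_toEuclideanLin, sq,
    ← mulVec_mulVec]
  rfl

end Euclidean

/-! ### The block matrix combining `W` and `W²` -/

section Block

variable {N : ℕ}

/-- The block matrix with diagonal blocks `2` and `B` and off-diagonal blocks `A`. -/
def blockMatrix (A B : Matrix (Fin N) (Fin N) ℝ) : Matrix (Fin N ⊕ Fin N) (Fin N ⊕ Fin N) ℝ :=
  fromBlocks ((2 : ℝ) • 1) A A B

lemma quadForm_blockMatrix {A : Matrix (Fin N) (Fin N) ℝ} (hA : A.IsHermitian)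
    (B : Matrix (Fin N) (Fin N) ℝ) (u v : Fin N → ℝ) :
    Sum.elim u v ⬝ᵥ blockMatrix A B *ᵥ Sum.elim u v =
      2 * (u ⬝ᵥ u) + 2 * (u ⬝ᵥ A *ᵥ v) + v ⬝ᵥ B *ᵥ v := by
  have hA' : v ⬝ᵥ A *ᵥ u = u ⬝ᵥ A *ᵥ v := by
    have : Aᵀ = A := by rw [← conjTranspose_eq_transpose_of_trivial]; exact hA
    rw [dotProduct_comm, ← vecMul_transpose, this, ← dotProduct_mulVec]
  rw [blockMatrix, fromBlocks_mulVec, sumElim_dotProduct_sumElim]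
  simp only [Sum.elim_comp_inl, Sum.elim_comp_inr, dotProduct_add, hA', smul_mulVec, one_mulVec,
    dotProduct_smul, smul_eq_mul]
  ring

lemma posDef_blockMatrix_of_pos {A B : Matrix (Fin N) (Fin N) ℝ} (hA : A.IsHermitian)
    (hB : B.IsHermitian) (h : ∀ u v : Fin N → ℝ, u ≠ 0 ∨ v ≠ 0 →
      0 < 2 * (u ⬝ᵥ u) + 2 * (u ⬝ᵥ A *ᵥ v) + v ⬝ᵥ B *ᵥ v) : (blockMatrix A B).PosDef := by
  refine PosDef.of_dotProduct_mulVec_pos ?_ fun z hz => ?_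
  · exact IsHermitian.fromBlocks (by ext i j; simp [one_apply, eq_comm]) hA hB
  · obtain ⟨u, v, rfl⟩ : ∃ u v : Fin N → ℝ, z = Sum.elim u v :=
      ⟨z ∘ Sum.inl, z ∘ Sum.inr, (Sum.elim_comp_inl_inr z).symm⟩
    rw [star_trivial, quadForm_blockMatrix hA]
    refine h u v ?_
    by_contra! hc
    exact hz (by rw [hc.1, hc.2]; ext (i | i) <;> rfl)

lemma dotProduct_self_pos {u : Fin N → ℝ} (hu : u ≠ 0) : 0 < u ⬝ᵥ u := by
  simpa using (dotProduct_star_self_pos_iff (v := u)).2 hu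

lemma dotProduct_self_nonneg (u : Fin N → ℝ) : 0 ≤ u ⬝ᵥ u :=
  Finset.sum_nonneg fun i _ => mul_self_nonneg (u i)

lemma dotProduct_sq_mulVec {A : Matrix (Fin N) (Fin N) ℝ} (hA : A.IsHermitian) (v : Fin N → ℝ) :
    v ⬝ᵥ (A ^ 2) *ᵥ v = A *ᵥ v ⬝ᵥ A *ᵥ v := by
  have : Aᵀ = A := by rw [← conjTranspose_eq_transpose_of_trivial]; exact hA
  rw [sq, ← mulVec_mulVec, dotProduct_mulVec, ← mulVec_transpose, this]

/-- The form equals `|u + A v|² + |u|²`. The entry `2` supplies the second square; with `1` in its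
place the matrix would be singular. -/
lemma posDef_blockMatrix_sq {A : Matrix (Fin N) (Fin N) ℝ} (hA : A.PosDef) :
    (blockMatrix A (A ^ 2)).PosDef := by
  refine posDef_blockMatrix_of_pos hA.1 (hA.1.pow 2) fun u v huv => ?_
  rw [dotProduct_sq_mulVec hA.1]
  have h0 : (u + A *ᵥ v) ⬝ᵥ (u + A *ᵥ v) =
      u ⬝ᵥ u + 2 * (u ⬝ᵥ A *ᵥ v) + A *ᵥ v ⬝ᵥ A *ᵥ v := by
    rw [add_dotProduct, dotProduct_add, dotProduct_add, dotProduct_comm (A *ᵥ v) u]; ring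
  have h1 := dotProduct_self_nonneg (u + A *ᵥ v)
  by_cases hu : u = 0
  · have hv : v ≠ 0 := by tauto
    have hAv : A *ᵥ v ≠ 0 := fun h => hv <|
      mulVec_injective_of_isUnit hA.isUnit (by rw [h, mulVec_zero])
    simpa [hu] using dotProduct_self_pos hAv
  · have := dotProduct_self_pos hu
    linarith

lemma posDef_blockMatrix_zero {B : Matrix (Fin N) (Fin N) ℝ} (hB : B.PosDef) :
    (blockMatrix 0 B).PosDef := by
  refine posDef_blockMatrix_of_pos isHermitian_zero hB.1 fun u v huv => ?_
  simp only [zero_mulVec, dotProduct_zero, mul_zero, add_zero]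
  have h2 := hB.posSemidef.dotProduct_mulVec_nonneg v
  rw [star_trivial] at h2
  by_cases hu : u = 0
  · have hv : v ≠ 0 := by tauto
    have h1 := hB.dotProduct_mulVec_pos hv
    rw [star_trivial] at h1
    simpa [hu] using h1
  · have := dotProduct_self_pos hu
    linarith

lemma det_blockMatrix (A B : Matrix (Fin N) (Fin N) ℝ) :
    (blockMatrix A B).det = 2 ^ N * (B - (1 / 2 : ℝ) • (A * A)).det := by
  let _ : Invertible ((2 : ℝ) • (1 : Matrix (Fin N) (Fin N) ℝ)) :=
    ⟨(1 / 2 : ℝ) • 1, by simp [smul_smul], by simp [smul_smul]⟩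
  have hinv : ⅟((2 : ℝ) • (1 : Matrix (Fin N) (Fin N) ℝ)) = (1 / 2 : ℝ) • 1 := rfl
  rw [blockMatrix, det_fromBlocks₁₁, hinv, det_smul, det_one, Fintype.card_fin]
  simp

/-- The Schur complement is `A²/2`, and its factor `2⁻ᴺ` cancels the determinant `2ᴺ` of the corner.
Thus the block matrix has the same `log det` as the one in the `A_∞` condition. -/
lemma det_blockMatrix_sq (A : Matrix (Fin N) (Fin N) ℝ) :
    (blockMatrix A (A ^ 2)).det = (A ^ 2).det := by
  rw [det_blockMatrix, ← sq, show A ^ 2 - (1 / 2 : ℝ) • A ^ 2 = (1 / 2 : ℝ) • A ^ 2 by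
    module, det_smul, Fintype.card_fin, ← mul_assoc, ← mul_pow]
  norm_num

/-- Fischer's inequality for the block matrix. -/
lemma log_det_blockMatrix_le {A B : Matrix (Fin N) (Fin N) ℝ} (hB : B.PosDef)
    (hM : (blockMatrix A B).PosDef) :
    Real.log (blockMatrix A B).det ≤ N * Real.log 2 + Real.log B.det := by
  -- Relative to its own block diagonal part the matrix has trace term exactly `2N`, so the
  -- divergence reduces to a difference of log determinants.
  have h := logDetDivergence_nonneg (posDef_blockMatrix_zero hB) hM
  have hinv : (blockMatrix 0 B)⁻¹ = fromBlocks ((1 / 2 : ℝ) • 1) 0 0 B⁻¹ := by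
    refine inv_eq_right_inv ?_
    rw [blockMatrix, fromBlocks_multiply]
    simp [smul_smul, mul_nonsing_inv _ hB.det_pos.ne'.isUnit]
  have htr : ∀ P Q R S : Matrix (Fin N) (Fin N) ℝ,
      (fromBlocks P Q R S).trace = P.trace + S.trace := fun P Q R S => by
    simp [trace, Fintype.sum_sum_type]
  rw [logDetDivergence, hinv, blockMatrix, fromBlocks_multiply, htr] at h
  simp only [ Matrix.zero_mul, add_zero, zero_add, smul_mul_smul_comm,
    Matrix.one_mul, nonsing_inv_mul _ hB.det_pos.ne'.isUnit, trace_one] at h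
  rw [← blockMatrix, det_blockMatrix 0 B] at h
  simp only [Matrix.mul_zero, smul_zero, sub_zero, Fintype.card_sum, Fintype.card_fin] at h
  rw [Real.log_mul (by positivity) hB.det_pos.ne', Real.log_pow] at h
  norm_num at h
  linarith

lemma quadForm_le_of_logDetDivergence_le {A B A' B' : Matrix (Fin N) (Fin N) ℝ} (hA : A.IsHermitian)
    (hA' : A'.IsHermitian) (hM : (blockMatrix A B).PosDef) (hM' : (blockMatrix A' B').PosDef)
    {τ : ℝ} (hτ : 0 ≤ τ) (hτ1 : τ ≤ 1)
    (h : logDetDivergence (blockMatrix A B) (blockMatrix A' B') ≤ τ ^ 2) (v : Fin N → ℝ) :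
    v ⬝ᵥ B' *ᵥ v ≤ (1 + 3 * τ) * (v ⬝ᵥ B *ᵥ v) := by
  have h1 := abs_quadForm_sub_le hM hM' hτ hτ1 h (Sum.elim 0 v)
  rw [quadForm_blockMatrix hA, quadForm_blockMatrix hA'] at h1
  simp only [zero_dotProduct, mul_zero, zero_add] at h1
  linarith [(abs_le.1 h1).2]

/-- Polarization: comparing the forms at `(u, v)` and `(-u, v)` cancels the diagonal blocks and
isolates `4 (u, (A' - A) v)`. -/
lemma abs_dotProduct_sub_mulVec_le {A B A' B' : Matrix (Fin N) (Fin N) ℝ} (hA : A.IsHermitian)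
    (hA' : A'.IsHermitian) (hM : (blockMatrix A B).PosDef) (hM' : (blockMatrix A' B').PosDef)
    {τ : ℝ} (hτ : 0 ≤ τ) (hτ1 : τ ≤ 1)
    (h : logDetDivergence (blockMatrix A B) (blockMatrix A' B') ≤ τ ^ 2)
    (u v : Fin N → ℝ) :
    |u ⬝ᵥ A' *ᵥ v - u ⬝ᵥ A *ᵥ v| ≤ 3 * τ / 2 * (2 * (u ⬝ᵥ u) + v ⬝ᵥ B *ᵥ v) := by
  have h1 := abs_le.1 (abs_quadForm_sub_le hM hM' hτ hτ1 h (Sum.elim u v))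
  have h2 := abs_le.1 (abs_quadForm_sub_le hM hM' hτ hτ1 h (Sum.elim (-u) v))
  rw [quadForm_blockMatrix hA, quadForm_blockMatrix hA'] at h1 h2
  simp only [neg_dotProduct, dotProduct_neg, neg_neg] at h2
  rw [abs_le]
  constructor <;> linarith [h1.1, h1.2, h2.1, h2.2]

end Block

end LocalTb

namespace LocalTb

open Matrix

/-! ### Reverse Hölder inequality and consequences of the `A_∞` condition -/

section Weight

variable {α : Type*} [MeasurableSpace α] {N : ℕ}

lemma posDef_sq {A : Matrix (Fin N) (Fin N) ℝ} (hA : A.PosDef) : (A ^ 2).PosDef := by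
  have := PosDef.conjTranspose_mul_self A (mulVec_injective_of_isUnit hA.isUnit)
  rwa [hA.1, ← sq] at this

lemma memLp_entry_of_integrable_sq {ν : Measure α} {W : α → Matrix (Fin N) (Fin N) ℝ}
    (hm : ∀ i j, AEMeasurable (fun x => W x i j) ν) (hW : ∀ᵐ x ∂ν, (W x).PosDef)
    (hint : ∀ i j, Integrable (fun x => (W x ^ 2) i j) ν) (i j : Fin N) :
    MemLp (fun x => W x i j) 2 ν := by
  rw [memLp_two_iff_integrable_sq (hm i j).aestronglyMeasurable]
  refine (hint i i).mono' ((hm i j).pow_const 2).aestronglyMeasurable ?_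
  filter_upwards [hW] with x hx
  rw [Real.norm_of_nonneg (sq_nonneg _), sq (W x), mul_apply]
  have hsymm : ∀ k, W x i k * W x k i = W x i k ^ 2 := fun k => by
    rw [sq, ← hx.1.apply k i, star_trivial]
  simp only [hsymm]
  exact Finset.single_le_sum (f := fun k => W x i k ^ 2) (fun k _ => sq_nonneg _)
    (Finset.mem_univ j)

/-- The determinant `A_∞` condition for `W ^ 2` with respect to a single measure. -/
structure IsAInftyOn (ρ : Measure α) (W : α → Matrix (Fin N) (Fin N) ℝ) (K : ℝ) : Prop where
  posDef : ∀ᵐ x ∂ρ, (W x).PosDef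
  memLp : ∀ i j, MemLp (fun x => W x i j) 2 ρ
  integrable_sq : ∀ i j, Integrable (fun x => (W x ^ 2) i j) ρ
  integrable_log : Integrable (fun x => Real.log (W x ^ 2).det) ρ
  det_le : (expectation ρ fun x => W x ^ 2).det ≤ K * Real.exp (∫ x, Real.log (W x ^ 2).det ∂ρ)

lemma integrable_toEuclideanLin {ν : Measure α} {W : α → Matrix (Fin N) (Fin N) ℝ}
    (hW : ∀ i j, MemLp (fun x => W x i j) 2 ν) {b : α → EuclideanSpace ℝ (Fin N)}
    (hb : MemLp b 2 ν) : Integrable (fun x => toEuclideanLin (W x) (b x)) ν := by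
  refine Integrable.of_eval_piLp fun i => ?_
  have : ∀ x, toEuclideanLin (W x) (b x) i = ∑ j, W x i j * b x j := fun x => rfl
  simp only [this]
  exact integrable_finsetSum _ fun j _ => (hW i j).integrable_mul (hb.eval_piLp j)

lemma inner_integral_toEuclideanLin {ν : Measure α} {W : α → Matrix (Fin N) (Fin N) ℝ}
    (hpos : ∀ᵐ x ∂ν, (W x).PosDef) (hW : ∀ i j, MemLp (fun x => W x i j) 2 ν)
    {b : α → EuclideanSpace ℝ (Fin N)} (hb : MemLp b 2 ν) (w : EuclideanSpace ℝ (Fin N)) :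
    inner ℝ w (∫ x, toEuclideanLin (W x) (b x) ∂ν) =
      ∫ x, inner ℝ (toEuclideanLin (W x) w) (b x) ∂ν := by
  rw [← integral_inner (integrable_toEuclideanLin hW hb)]
  refine integral_congr_ae ?_
  filter_upwards [hpos] with x hx
  exact (inner_toEuclideanLin_comm hx.1 _ _).symm

lemma integrable_inner_toEuclideanLin {ν : Measure α} {W : α → Matrix (Fin N) (Fin N) ℝ}
    (hpos : ∀ᵐ x ∂ν, (W x).PosDef) (hW : ∀ i j, MemLp (fun x => W x i j) 2 ν)
    {b : α → EuclideanSpace ℝ (Fin N)} (hb : MemLp b 2 ν) (w : EuclideanSpace ℝ (Fin N)) :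
    Integrable (fun x => inner ℝ (toEuclideanLin (W x) w) (b x)) ν := by
  refine ((integrable_toEuclideanLin hW hb).const_inner w).congr ?_
  filter_upwards [hpos] with x hx
  exact (inner_toEuclideanLin_comm hx.1 _ _).symm

lemma integrable_norm_toEuclideanLin_sq {ν : Measure α} {W : α → Matrix (Fin N) (Fin N) ℝ}
    (hpos : ∀ᵐ x ∂ν, (W x).PosDef) (hint : ∀ i j, Integrable (fun x => (W x ^ 2) i j) ν)
    (w : EuclideanSpace ℝ (Fin N)) : Integrable (fun x => ‖toEuclideanLin (W x) w‖ ^ 2) ν := by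
  refine (integrable_dotProduct_mulVec hint w.ofLp w.ofLp).congr ?_
  filter_upwards [hpos] with x hx
  exact (norm_toEuclideanLin_sq hx.1 w).symm

variable {ρ : Measure α} [IsProbabilityMeasure ρ] {W : α → Matrix (Fin N) (Fin N) ℝ} {K : ℝ}

lemma expectation_blockMatrix (ρ : Measure α) [IsProbabilityMeasure ρ]
    (W : α → Matrix (Fin N) (Fin N) ℝ) :
    expectation ρ (fun x => blockMatrix (W x) (W x ^ 2)) =
      blockMatrix (expectation ρ W) (expectation ρ fun x => W x ^ 2) := by
  ext (i | i) (j | j) <;> simp [expectation, blockMatrix]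

namespace IsAInftyOn

lemma integrable (h : IsAInftyOn ρ W K) (i j : Fin N) : Integrable (fun x => W x i j) ρ :=
  (h.memLp i j).integrable one_le_two

lemma posDef_expectation (h : IsAInftyOn ρ W K) : (expectation ρ W).PosDef :=
  LocalTb.posDef_expectation h.integrable h.posDef

lemma posDef_expectation_sq (h : IsAInftyOn ρ W K) :
    (expectation ρ fun x => W x ^ 2).PosDef :=
  LocalTb.posDef_expectation h.integrable_sq (h.posDef.mono fun _ hx => posDef_sq hx)

lemma pos (h : IsAInftyOn ρ W K) : 0 < K :=
  pos_of_mul_pos_left (h.posDef_expectation_sq.det_pos.trans_le h.det_le) (Real.exp_pos _).le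

/-- Average `|W v - u|² ≥ 0` with `u = ⟨W⟩ v`. -/
lemma expectation_sq_le (h : IsAInftyOn ρ W K) (v : Fin N → ℝ) :
    v ⬝ᵥ (expectation ρ W) ^ 2 *ᵥ v ≤ v ⬝ᵥ (expectation ρ fun x => W x ^ 2) *ᵥ v := by
  set u := expectation ρ W *ᵥ v with hu
  rw [dotProduct_sq_mulVec h.posDef_expectation.1, ← hu,
    dotProduct_expectation_mulVec h.integrable_sq]
  have h1 : ∫ x, (2 * (u ⬝ᵥ W x *ᵥ v) - u ⬝ᵥ u) ∂ρ ≤ ∫ x, v ⬝ᵥ (W x ^ 2) *ᵥ v ∂ρ := by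
    refine integral_mono_ae (((integrable_dotProduct_mulVec h.integrable u v).const_mul 2).sub
      (integrable_const _)) (integrable_dotProduct_mulVec h.integrable_sq v v) ?_
    filter_upwards [h.posDef] with x hx
    rw [dotProduct_sq_mulVec hx.1]
    have h0 := dotProduct_self_nonneg (u - W x *ᵥ v)
    rw [sub_dotProduct, dotProduct_sub, dotProduct_sub, dotProduct_comm (W x *ᵥ v) u] at h0
    linarith
  rw [integral_sub ((integrable_dotProduct_mulVec h.integrable u v).const_mul 2)
    (integrable_const _), integral_const_mul, ← dotProduct_expectation_mulVec h.integrable, ← hu,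
    integral_const] at h1
  simp only [probReal_univ, smul_eq_mul, one_mul] at h1
  linarith

/-- The matrix reverse Hölder inequality. -/
lemma reverseHolder (h : IsAInftyOn ρ W K) (v : Fin N → ℝ) :
    v ⬝ᵥ (expectation ρ fun x => W x ^ 2) *ᵥ v ≤
      K * (expectation ρ W *ᵥ v ⬝ᵥ expectation ρ W *ᵥ v) := by
  rw [← dotProduct_sq_mulVec h.posDef_expectation.1]
  -- Since `⟨W⟩² ≤ ⟨W²⟩`, a determinant comparison suffices. It follows from `A_∞` and Jensen for
  -- `W`: `exp ⟨log det W²⟩ ≤ (det ⟨W⟩)²`.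
  refine quadForm_le_of_det_le (posDef_sq h.posDef_expectation) h.posDef_expectation_sq
    h.expectation_sq_le (h.det_le.trans (mul_le_mul_of_nonneg_left ?_ h.pos.le)) v
  have hlog : ∀ x, Real.log (W x ^ 2).det = 2 * Real.log (W x).det := fun x => by
    rw [det_pow, Real.log_pow]; norm_num
  have hint : Integrable (fun x => Real.log (W x).det) ρ := by
    refine (h.integrable_log.const_mul (1 / 2)).congr (.of_forall fun x => ?_)
    simp only [hlog]; ring
  have h1 := integral_log_det_le h.integrable h.posDef hint
  have h0 := h.posDef_expectation.det_pos
  simp only [hlog, integral_const_mul]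
  rw [det_pow, ← Real.exp_log (pow_pos h0 2), Real.log_pow]
  exact Real.exp_le_exp.2 (by push_cast; linarith)

lemma integrable_block (h : IsAInftyOn ρ W K) (i j : Fin N ⊕ Fin N) :
    Integrable (fun x => blockMatrix (W x) (W x ^ 2) i j) ρ := by
  rcases i with i | i <;> rcases j with j | j
  · exact integrable_const _
  · exact h.integrable i j
  · exact h.integrable i j
  · exact h.integrable_sq i j

lemma posDef_block (h : IsAInftyOn ρ W K) :
    (blockMatrix (expectation ρ W) (expectation ρ fun x => W x ^ 2)).PosDef := by
  rw [← expectation_blockMatrix]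
  exact LocalTb.posDef_expectation h.integrable_block
    (h.posDef.mono fun _ hx => posDef_blockMatrix_sq hx)

lemma integral_log_le (h : IsAInftyOn ρ W K) :
    ∫ x, Real.log (W x ^ 2).det ∂ρ ≤
      Real.log (blockMatrix (expectation ρ W) (expectation ρ fun x => W x ^ 2)).det := by
  rw [← expectation_blockMatrix]
  have := integral_log_det_le h.integrable_block
    (h.posDef.mono fun _ hx => posDef_blockMatrix_sq hx) (by
      simpa only [det_blockMatrix_sq] using h.integrable_log)
  simpa only [det_blockMatrix_sq] using this

/-- Fischer's inequality discards the off-diagonal blocks, and `A_∞` bounds what remains. -/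
lemma log_det_block_le (h : IsAInftyOn ρ W K) :
    Real.log (blockMatrix (expectation ρ W) (expectation ρ fun x => W x ^ 2)).det ≤
      N * Real.log 2 + Real.log K + ∫ x, Real.log (W x ^ 2).det ∂ρ := by
  have h1 := log_det_blockMatrix_le h.posDef_expectation_sq h.posDef_block
  have h2 := Real.log_le_log h.posDef_expectation_sq.det_pos h.det_le
  rw [Real.log_mul h.pos.ne' (Real.exp_pos _).ne', Real.log_exp] at h2
  linarith

lemma integral_norm_sq_le (h : IsAInftyOn ρ W K) (w : EuclideanSpace ℝ (Fin N)) :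
    ∫ x, ‖toEuclideanLin (W x) w‖ ^ 2 ∂ρ ≤ K * ‖toEuclideanLin (expectation ρ W) w‖ ^ 2 := by
  have h1 := h.reverseHolder w.ofLp
  rw [← dotProduct_sq_mulVec h.posDef_expectation.1,
    ← norm_toEuclideanLin_sq h.posDef_expectation.1,
    dotProduct_expectation_mulVec h.integrable_sq] at h1
  refine le_trans (le_of_eq (integral_congr_ae ?_)) h1
  filter_upwards [h.posDef] with x hx
  exact norm_toEuclideanLin_sq hx.1 w

lemma toEuclideanLin_mul_inv (h : IsAInftyOn ρ W K) (v : EuclideanSpace ℝ (Fin N)) :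
    toEuclideanLin (expectation ρ W) (toEuclideanLin (expectation ρ W)⁻¹ v) = v := by
  have := h.posDef_expectation.det_pos.ne'.isUnit
  simp [toLpLin_apply, mul_nonsing_inv _ this]

/-- The matrix weighted average is bounded by the quadratic mean. -/
lemma norm_weighted_expectation_sq_le (h : IsAInftyOn ρ W K)
    {b : α → EuclideanSpace ℝ (Fin N)} (hb : MemLp b 2 ρ) :
    ‖toEuclideanLin (expectation ρ W)⁻¹ (∫ x, toEuclideanLin (W x) (b x) ∂ρ)‖ ^ 2 ≤
      K * ∫ x, ‖b x‖ ^ 2 ∂ρ := by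
  set e := toEuclideanLin (expectation ρ W)⁻¹ (∫ x, toEuclideanLin (W x) (b x) ∂ρ) with he
  -- Duality: this choice gives `|e|² = ⟨(W w, b)⟩`. In Young's inequality below, the weight
  -- `1/(2K)` lets reverse Hölder absorb the `W w` term into `|e|²/2`.
  set w := toEuclideanLin (expectation ρ W)⁻¹ e with hw
  have hAw : toEuclideanLin (expectation ρ W) w = e := h.toEuclideanLin_mul_inv e
  have h1 : ‖e‖ ^ 2 = ∫ x, inner ℝ (toEuclideanLin (W x) w) (b x) ∂ρ := by
    rw [← inner_integral_toEuclideanLin h.posDef h.memLp hb, ← real_inner_self_eq_norm_sq]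
    conv_lhs => rw [he]
    rw [← inner_toEuclideanLin_comm h.posDef_expectation.inv.1]
  have hK := h.pos
  have hbi : Integrable (fun x => ‖b x‖ ^ 2) ρ := hb.integrable_norm_pow two_ne_zero
  have h2 := h.integral_norm_sq_le w
  have hi := integrable_norm_toEuclideanLin_sq h.posDef h.integrable_sq w
  have h3 : ∫ x, inner ℝ (toEuclideanLin (W x) w) (b x) ∂ρ ≤
      ∫ x, (1 / (2 * K) * ‖toEuclideanLin (W x) w‖ ^ 2 + K / 2 * ‖b x‖ ^ 2) ∂ρ := by
    refine integral_mono (integrable_inner_toEuclideanLin h.posDef h.memLp hb w)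
      ((hi.const_mul _).add (hbi.const_mul _)) fun x => ?_
    refine (real_inner_le_norm _ _).trans ?_
    have := sq_nonneg (‖toEuclideanLin (W x) w‖ - K * ‖b x‖)
    field_simp
    nlinarith
  rw [integral_add (hi.const_mul _) (hbi.const_mul _), integral_const_mul, integral_const_mul,
    ← h1] at h3
  rw [hAw] at h2
  have h4 : 1 / (2 * K) * ∫ x, ‖toEuclideanLin (W x) w‖ ^ 2 ∂ρ ≤ ‖e‖ ^ 2 / 2 := by
    calc _ ≤ 1 / (2 * K) * (K * ‖e‖ ^ 2) := by gcongr
      _ = _ := by field_simp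
  linarith

end IsAInftyOn

end Weight

end LocalTb

namespace LocalTb

/-! ### Dyadic cubes and Whitney regions -/

section Dyadic

variable {n : ℕ}

lemma dyadicCube_eq_cube (k : ℤ) (m : Fin n → ℤ) :
    dyadicCube k m = cube (fun i => (2 : ℝ) ^ k * (m i + 1 / 2)) ((2 : ℝ) ^ k) := by
  unfold dyadicCube cube
  congr! 3 <;> ring

lemma measurableSet_dyadicCube (k : ℤ) (m : Fin n → ℤ) : MeasurableSet (dyadicCube k m) :=
  MeasurableSet.univ_pi fun _ => measurableSet_Ico

lemma mem_dyadicCube_iff {k : ℤ} {m : Fin n → ℤ} {x : Fin n → ℝ} :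
    x ∈ dyadicCube k m ↔ ∀ i, ⌊x i / (2 : ℝ) ^ k⌋ = m i := by
  have h : (0 : ℝ) < 2 ^ k := by positivity
  simp only [dyadicCube, Set.mem_univ_pi, Set.mem_Ico, Int.floor_eq_iff, le_div_iff₀ h,
    div_lt_iff₀ h, mul_comm]

/-- The lower corner indices of the dyadic children of a dyadic cube. -/
def childIndex (m : Fin n → ℤ) (e : Fin n → Fin 2) : Fin n → ℤ := fun i => 2 * m i + (e i : ℕ)

lemma floor_two_mul_eq (q : ℝ) : ⌊2 * q⌋ = 2 * ⌊q⌋ ∨ ⌊2 * q⌋ = 2 * ⌊q⌋ + 1 := by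
  have h1 : 2 * ⌊q⌋ ≤ ⌊2 * q⌋ := Int.le_floor.2 (by push_cast; linarith [Int.floor_le q])
  have h2 : ⌊2 * q⌋ < 2 * ⌊q⌋ + 2 := Int.floor_lt.2 (by
    push_cast; linarith [Int.lt_floor_add_one q])
  omega

lemma div_zpow_sub_one (x : ℝ) (k : ℤ) : x / (2 : ℝ) ^ (k - 1) = 2 * (x / 2 ^ k) := by
  rw [zpow_sub_one₀ two_ne_zero]
  field_simp

lemma dyadicCube_eq_iUnion_children (k : ℤ) (m : Fin n → ℤ) :
    dyadicCube k m = ⋃ e, dyadicCube (k - 1) (childIndex m e) := by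
  ext x
  simp only [Set.mem_iUnion, mem_dyadicCube_iff, childIndex, div_zpow_sub_one]
  constructor
  · intro h
    refine ⟨fun i => if ⌊2 * (x i / 2 ^ k)⌋ = 2 * m i then 0 else 1, fun i => ?_⟩
    have := floor_two_mul_eq (x i / 2 ^ k)
    rw [h i] at this
    dsimp only
    split_ifs with h' <;> simp <;> omega
  · rintro ⟨e, he⟩ i
    have := floor_two_mul_eq (x i / 2 ^ k)
    have := (e i).isLt
    have := he i
    omega

lemma pairwise_disjoint_dyadicCube (k : ℤ) :
    Pairwise fun m m' : Fin n → ℤ => Disjoint (dyadicCube k m) (dyadicCube k m') := by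
  intro m m' h
  refine Set.disjoint_left.2 fun x hx hx' => h (funext fun i => ?_)
  rw [← mem_dyadicCube_iff.1 hx i, mem_dyadicCube_iff.1 hx' i]

lemma childIndex_injective (m : Fin n → ℤ) : Function.Injective (childIndex m) := by
  intro e e' h
  funext i
  have := congrFun h i
  simp only [childIndex] at this
  exact Fin.ext (by omega)

lemma pairwise_disjoint_children (k : ℤ) (m : Fin n → ℤ) :
    Pairwise fun e e' => Disjoint (dyadicCube k (childIndex m e)) (dyadicCube k (childIndex m e')) :=
  fun _ _ h => pairwise_disjoint_dyadicCube k ((childIndex_injective m).ne h)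

lemma dyadicCube_child_subset (k : ℤ) (m : Fin n → ℤ) (e : Fin n → Fin 2) :
    dyadicCube (k - 1) (childIndex m e) ⊆ dyadicCube k m := by
  rw [dyadicCube_eq_iUnion_children k m]
  exact Set.subset_iUnion (fun e => dyadicCube (k - 1) (childIndex m e)) e

lemma measure_dyadicCube_lt_top {μ : Measure (Fin n → ℝ)} {C : ℝ≥0} (hμ : IsDoublingWith μ C)
    (k : ℤ) (m : Fin n → ℤ) : μ (dyadicCube k m) < ∞ := by
  have := hμ.locallyFinite
  have hb : Bornology.IsBounded (dyadicCube k m) :=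
    Bornology.IsBounded.pi fun _ => Metric.isBounded_Ico _ _
  exact hb.measure_lt_top

/-- The fourfold concentric dilate of a child contains its parent, so two doublings suffice. -/
lemma measure_dyadicCube_le_child {μ : Measure (Fin n → ℝ)} {C : ℝ≥0} (hμ : IsDoublingWith μ C)
    (k : ℤ) (m : Fin n → ℤ) (e : Fin n → Fin 2) :
    μ (dyadicCube k m) ≤ (C : ℝ≥0∞) ^ 2 * μ (dyadicCube (k - 1) (childIndex m e)) := by
  have h0 : (0 : ℝ) < 2 ^ (k - 1) := by positivity
  set c : Fin n → ℝ := fun i => (2 : ℝ) ^ (k - 1) * (childIndex m e i + 1 / 2) with hc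
  have hsub : dyadicCube k m ⊆ cube c (2 * (2 * 2 ^ (k - 1))) := by
    refine Set.pi_mono fun i _ => Set.Ico_subset_Ico ?_ ?_
    all_goals
      have h2 : (2 : ℝ) ^ k = 2 * 2 ^ (k - 1) := by rw [zpow_sub_one₀ two_ne_zero]; ring
      have h3 : ((e i : ℕ) : ℝ) ≤ 1 := by exact_mod_cast Nat.lt_succ_iff.1 (e i).isLt
      have h4 : (0 : ℝ) ≤ ((e i : ℕ) : ℝ) := by positivity
      simp only [hc, childIndex]
      push_cast
      rw [h2]
      nlinarith
  calc μ (dyadicCube k m) ≤ μ (cube c (2 * (2 * 2 ^ (k - 1)))) := measure_mono hsub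
    _ ≤ C * μ (cube c (2 * 2 ^ (k - 1))) := hμ.doubling _ _ (by positivity)
    _ ≤ C * (C * μ (cube c (2 ^ (k - 1)))) := by gcongr; exact hμ.doubling _ _ h0
    _ = _ := by rw [dyadicCube_eq_cube, sq, mul_assoc]

/-- On the Whitney region `(ℓ(Q)/2, ℓ(Q)] × Q` the operator `E_t` is the single average `E_Q`; the
half-open interval matches the rounding in `Int.clog`. -/
lemma dyadicCubeAt_eq {k : ℤ} {m : Fin n → ℤ} {t : ℝ} {x : Fin n → ℝ}
    (ht : t ∈ Set.Ioc ((2 : ℝ) ^ (k - 1)) (2 ^ k)) (hx : x ∈ dyadicCube k m) :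
    dyadicCubeAt t x = dyadicCube k m := by
  have ht0 : 0 < t := lt_trans (by positivity) ht.1
  have h1 : Int.clog 2 t ≤ k :=
    (Int.le_zpow_iff_clog_le (b := 2) one_lt_two ht0).1 (by exact_mod_cast ht.2)
  have h2 : k - 1 < Int.clog 2 t :=
    (Int.zpow_lt_iff_lt_clog (b := 2) one_lt_two ht0).1 (by exact_mod_cast ht.1)
  have h3 : Int.clog 2 t = k := by omega
  rw [dyadicCubeAt, h3]
  congr 1
  exact funext (mem_dyadicCube_iff.1 hx)

lemma lintegral_dyadic_split (Θ : Measure (ℝ × (Fin n → ℝ))) (f : ℝ × (Fin n → ℝ) → ℝ≥0∞)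
    (k : ℤ) (m : Fin n → ℤ) {s : ℝ} (hs : s ≤ 2 ^ (k - 1)) :
    ∫⁻ p in Set.Ioc s (2 ^ k) ×ˢ dyadicCube k m, f p ∂Θ =
      ∫⁻ p in Set.Ioc (2 ^ (k - 1)) (2 ^ k) ×ˢ dyadicCube k m, f p ∂Θ +
      ∑ e, ∫⁻ p in Set.Ioc s (2 ^ (k - 1)) ×ˢ dyadicCube (k - 1) (childIndex m e), f p ∂Θ := by
  have hk : (2 : ℝ) ^ (k - 1) ≤ 2 ^ k := zpow_le_zpow_right₀ one_le_two (by omega)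
  have hset : Set.Ioc s (2 ^ k) ×ˢ dyadicCube k m =
      Set.Ioc ((2 : ℝ) ^ (k - 1)) (2 ^ k) ×ˢ dyadicCube k m ∪
        ⋃ e, Set.Ioc s (2 ^ (k - 1)) ×ˢ dyadicCube (k - 1) (childIndex m e) := by
    rw [← Set.prod_iUnion, ← dyadicCube_eq_iUnion_children, ← Set.union_prod, Set.union_comm,
      Set.Ioc_union_Ioc_eq_Ioc hs hk]
  have hmeas : ∀ e, MeasurableSet
      (Set.Ioc s ((2 : ℝ) ^ (k - 1)) ×ˢ dyadicCube (k - 1) (childIndex m e)) :=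
    fun e => measurableSet_Ioc.prod (measurableSet_dyadicCube _ _)
  rw [hset, lintegral_union (MeasurableSet.iUnion hmeas), lintegral_iUnion hmeas, tsum_fintype]
  · exact fun e e' h => Set.disjoint_prod.2 (Or.inr (pairwise_disjoint_children _ _ h))
  · refine Set.disjoint_iUnion_right.2 fun e => Set.disjoint_prod.2 (Or.inl ?_)
    rw [disjoint_comm]
    exact Set.Ioc_disjoint_Ioc_of_le le_rfl

lemma integral_dyadic_split {μ : Measure (Fin n → ℝ)} {g : (Fin n → ℝ) → ℝ} {k : ℤ}
    {m : Fin n → ℤ} (hg : IntegrableOn g (dyadicCube k m) μ) :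
    ∫ x in dyadicCube k m, g x ∂μ =
      ∑ e, ∫ x in dyadicCube (k - 1) (childIndex m e), g x ∂μ := by
  rw [dyadicCube_eq_iUnion_children k m]
  refine integral_iUnion_fintype (fun e => measurableSet_dyadicCube _ _)
    (pairwise_disjoint_children _ _) fun e => hg.mono_set (dyadicCube_child_subset _ _ _)

end Dyadic

/-! ### Passage to normalized measures on cubes -/

section CubeMeasure

variable {n N : ℕ} {μ : Measure (Fin n → ℝ)} {Q : Set (Fin n → ℝ)}

/-- The normalized restriction of `μ` to `Q`. -/
noncomputable def cubeMeasure (μ : Measure (Fin n → ℝ)) (Q : Set (Fin n → ℝ)) : Measure (Fin n → ℝ) :=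
  (μ.restrict Q Set.univ)⁻¹ • μ.restrict Q

lemma isProbabilityMeasure_cubeMeasure (h0 : μ Q ≠ 0) (h1 : μ Q ≠ ∞) :
    IsProbabilityMeasure (cubeMeasure μ Q) := by
  refine ⟨?_⟩
  simp [cubeMeasure, ENNReal.inv_mul_cancel h0 h1]

lemma setIntegral_eq_smul {E : Type*} [NormedAddCommGroup E] [NormedSpace ℝ E] (h1 : μ Q ≠ ∞)
    (f : (Fin n → ℝ) → E) : ∫ x in Q, f x ∂μ = μ.real Q • ∫ x, f x ∂cubeMeasure μ Q :=
  (measure_smul_setAverage f h1).symm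

lemma inv_restrict_univ_ne_top (h0 : μ Q ≠ 0) : (μ.restrict Q Set.univ)⁻¹ ≠ ∞ := by
  simpa using h0

lemma isAInftyOn_cubeMeasure {W : (Fin n → ℝ) → Matrix (Fin N) (Fin N) ℝ}
    (hW : IsMatrixWeight μ W) {K₀ K : ℝ} (hWA : IsMatrixAInfty μ (fun x => W x ^ 2) K₀)
    (hK : K₀ ≤ K) {k : ℤ} {m : Fin n → ℤ} (h0 : μ (dyadicCube k m) ≠ 0) :
    IsAInftyOn (cubeMeasure μ (dyadicCube k m)) W K := by
  obtain ⟨h1, h2, h3⟩ := hWA (fun i => (2 : ℝ) ^ k * (m i + 1 / 2)) (2 ^ k) (by positivity)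
  rw [← dyadicCube_eq_cube] at h1 h2 h3
  have hpos : ∀ᵐ x ∂μ.restrict (dyadicCube k m), (W x).PosDef := ae_restrict_of_ae hW.posDef
  have hc := inv_restrict_univ_ne_top h0
  refine ⟨Measure.ae_smul_measure hpos _, fun i j => ?_, fun i j => (h1 i j).smul_measure hc,
    h2.smul_measure hc, h3.trans ?_⟩
  · exact (memLp_entry_of_integrable_sq (fun i j => (hW.aemeasurable i j).restrict) hpos h1 i
      j).smul_measure hc
  · exact mul_le_mul_of_nonneg_right hK (Real.exp_pos _).le

lemma weightedAverage_eq (h0 : μ Q ≠ 0) (h1 : μ Q ≠ ∞)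
    (W : (Fin n → ℝ) → Matrix (Fin N) (Fin N) ℝ)
    (hA : (expectation (cubeMeasure μ Q) W).PosDef) (b : (Fin n → ℝ) → EuclideanSpace ℝ (Fin N)) :
    weightedAverage μ W Q b = Matrix.toEuclideanLin (expectation (cubeMeasure μ Q) W)⁻¹
      (∫ x, Matrix.toEuclideanLin (W x) (b x) ∂cubeMeasure μ Q) := by
  have hr : μ.real Q ≠ 0 := (ENNReal.toReal_pos h0 h1).ne'
  have hM : matrixIntegral μ Q W = μ.real Q • expectation (cubeMeasure μ Q) W := by
    ext i j
    simp only [matrixIntegral, expectation, Matrix.of_apply, Matrix.smul_apply]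
    exact setIntegral_eq_smul h1 _
  let _ : Invertible (μ.real Q) := invertibleOfNonzero hr
  rw [weightedAverage, hM, setIntegral_eq_smul h1, Matrix.inv_smul _ _ hA.det_pos.ne'.isUnit,
    map_smul, map_smul, LinearMap.smul_apply, smul_smul, mul_invOf_self, one_smul]

end CubeMeasure

end LocalTb

namespace LocalTb

open Matrix

/-! ### The stopping condition and its controlling density -/

section Stopping

variable {α : Type*} [MeasurableSpace α] {N : ℕ}

/-- The block matrix built from the averages of `W` and `W ^ 2`. -/
noncomputable def blockExpectation (ρ : Measure α) (W : α → Matrix (Fin N) (Fin N) ℝ) :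
    Matrix (Fin N ⊕ Fin N) (Fin N ⊕ Fin N) ℝ :=
  blockMatrix (expectation ρ W) (expectation ρ fun x => W x ^ 2)

/-- The defect in Jensen's inequality for `log det` of the block matrix. -/
noncomputable def jensenDefect (ρ : Measure α) (W : α → Matrix (Fin N) (Fin N) ℝ) : ℝ :=
  Real.log (blockExpectation ρ W).det - ∫ x, Real.log (W x ^ 2).det ∂ρ

/-- The matrix weighted average of `b` with respect to `ρ`. -/
noncomputable def weightedExpectation (ρ : Measure α) (W : α → Matrix (Fin N) (Fin N) ℝ)
    (b : α → EuclideanSpace ℝ (Fin N)) : EuclideanSpace ℝ (Fin N) :=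
  toEuclideanLin (expectation ρ W)⁻¹ (∫ x, toEuclideanLin (W x) (b x) ∂ρ)

/-- The density whose integral over a cube controls the stopping time argument that starts from
the measure `ρ`. -/
noncomputable def stoppingDensity (ρ : Measure α) (W : α → Matrix (Fin N) (Fin N) ℝ)
    (b : α → EuclideanSpace ℝ (Fin N)) (u : EuclideanSpace ℝ (Fin N)) (a κ s : ℝ) (x : α) : ℝ :=
  1 + a * (((blockExpectation ρ W)⁻¹ * blockMatrix (W x) (W x ^ 2)).trace +
      (Real.log (blockExpectation ρ W).det - 2 * N) - Real.log (W x ^ 2).det) +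
    κ * (5 / 8 + s⁻¹ * ‖b x‖ ^ 2 - inner ℝ (toEuclideanLin (W x) u) (b x))

/-- The stopping condition for the measure `σ` in a stopping time argument starting from `ρ`. -/
def IsStopping (ρ σ : Measure α) (W : α → Matrix (Fin N) (Fin N) ℝ)
    (b : α → EuclideanSpace ℝ (Fin N)) (v : EuclideanSpace ℝ (Fin N)) (τ ε : ℝ) : Prop :=
  τ ^ 2 < logDetDivergence (blockExpectation ρ W) (blockExpectation σ W) ∨
    1 < 4 * ε * ‖weightedExpectation σ W b‖ ∨ inner ℝ v (weightedExpectation σ W b) < 1 / 2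

variable {ρ σ : Measure α} [IsProbabilityMeasure ρ] [IsProbabilityMeasure σ]
  {W : α → Matrix (Fin N) (Fin N) ℝ} {K : ℝ} {b : α → EuclideanSpace ℝ (Fin N)}
  {u v : EuclideanSpace ℝ (Fin N)} {a κ s τ ε C : ℝ}

lemma integrable_stoppingDensity (hσ : IsAInftyOn σ W K) (hb : MemLp b 2 σ) (ρ : Measure α)
    (u : EuclideanSpace ℝ (Fin N)) (a κ s : ℝ) :
    Integrable (stoppingDensity ρ W b u a κ s) σ := by
  have h1 := integrable_trace_mul (blockExpectation ρ W)⁻¹ hσ.integrable_block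
  have h2 := integrable_inner_toEuclideanLin hσ.posDef hσ.memLp hb u
  have h3 : Integrable (fun x => ‖b x‖ ^ 2) σ := hb.integrable_norm_pow two_ne_zero
  exact ((integrable_const _).add (((h1.add (integrable_const _)).sub hσ.integrable_log).const_mul
    a)).add ((((integrable_const _).add (h3.const_mul _)).sub h2).const_mul κ)

/-- The trace is linear in the block matrix, so averaging puts `⟨P⟩_σ` in its place; adding and
subtracting `log det ⟨P⟩_σ` separates the Jensen defect of `σ` from its divergence relative to `ρ`.
-/
lemma integral_stoppingDensity (hσ : IsAInftyOn σ W K) (hb : MemLp b 2 σ) (ρ : Measure α)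
    (u : EuclideanSpace ℝ (Fin N)) (a κ s : ℝ) :
    ∫ x, stoppingDensity ρ W b u a κ s x ∂σ = 1 + a * (jensenDefect σ W +
      logDetDivergence (blockExpectation ρ W) (blockExpectation σ W)) +
      κ * (5 / 8 + s⁻¹ * ∫ x, ‖b x‖ ^ 2 ∂σ - ∫ x, inner ℝ (toEuclideanLin (W x) u) (b x) ∂σ) := by
  have h1 := integrable_trace_mul (blockExpectation ρ W)⁻¹ hσ.integrable_block
  have h2 := integrable_inner_toEuclideanLin hσ.posDef hσ.memLp hb u
  have h3 : Integrable (fun x => ‖b x‖ ^ 2) σ := hb.integrable_norm_pow two_ne_zero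
  have h4 := (h1.add (integrable_const (Real.log (blockExpectation ρ W).det - 2 * N))).sub
    hσ.integrable_log
  have h5 := ((integrable_const (5 / 8 : ℝ)).add (h3.const_mul s⁻¹)).sub h2
  have e1 := integral_add ((integrable_const (1 : ℝ)).add (h4.const_mul a)) (h5.const_mul κ)
  have e2 := integral_add (integrable_const (μ := σ) (1 : ℝ)) (h4.const_mul a)
  have e3 := integral_sub (h1.add (integrable_const (Real.log (blockExpectation ρ W).det - 2 * N)))
    hσ.integrable_log
  have e4 := integral_add h1 (integrable_const (Real.log (blockExpectation ρ W).det - 2 * N))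
  have e5 := integral_sub ((integrable_const (5 / 8 : ℝ)).add (h3.const_mul s⁻¹)) h2
  have e6 := integral_add (integrable_const (μ := σ) (5 / 8 : ℝ)) (h3.const_mul s⁻¹)
  have e7 := trace_mul_expectation (blockExpectation ρ W)⁻¹ hσ.integrable_block
  rw [expectation_blockMatrix, ← blockExpectation] at e7
  simp only [Pi.add_apply, Pi.sub_apply, integral_const_mul, integral_const, probReal_univ,
    one_smul] at e1 e2 e3 e4 e5 e6
  rw [e2, e3, e4, e5, e6, ← e7] at e1
  refine Eq.trans e1 ?_
  simp only [jensenDefect, logDetDivergence, Fintype.card_sum, Fintype.card_fin]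
  push_cast
  ring

lemma jensenDefect_nonneg (hσ : IsAInftyOn σ W K) : 0 ≤ jensenDefect σ W :=
  sub_nonneg.2 hσ.integral_log_le

lemma jensenDefect_le (hσ : IsAInftyOn σ W K) :
    jensenDefect σ W ≤ N * Real.log 2 + Real.log K := by
  have := hσ.log_det_block_le
  rw [jensenDefect, blockExpectation]
  linarith

lemma integral_inner_le {ν : Measure α} (hν : IsAInftyOn ν W K) (hb : MemLp b 2 ν) (hs : 0 < s)
    (hu : ∫ x, ‖toEuclideanLin (W x) u‖ ^ 2 ∂ν ≤ C) :
    ∫ x, inner ℝ (toEuclideanLin (W x) u) (b x) ∂ν ≤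
      s * C / 2 + s⁻¹ * (∫ x, ‖b x‖ ^ 2 ∂ν) / 2 := by
  have h1 := integrable_norm_toEuclideanLin_sq hν.posDef hν.integrable_sq u
  have h3 : Integrable (fun x => ‖b x‖ ^ 2) ν := hb.integrable_norm_pow two_ne_zero
  have h := integral_mono (integrable_inner_toEuclideanLin hν.posDef hν.memLp hb u)
    ((h1.const_mul (s / 2)).add (h3.const_mul (s⁻¹ / 2))) fun x => by
      refine (real_inner_le_norm _ _).trans ?_
      have := sq_nonneg (s * ‖toEuclideanLin (W x) u‖ - ‖b x‖)
      simp only [Pi.add_apply]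
      field_simp
      nlinarith
  have e := integral_add (h1.const_mul (s / 2)) (h3.const_mul (s⁻¹ / 2))
  simp only [Pi.add_apply, integral_const_mul] at e h
  rw [e] at h
  nlinarith

/-- The last bracket is at least `-C s / 2`, and `κ C s = 1` limits the loss to `1/2`, which the
constant `1` covers. -/
lemma integral_stoppingDensity_nonneg (hρ : IsAInftyOn ρ W K) (hσ : IsAInftyOn σ W K)
    (hb : MemLp b 2 σ) (ha : 0 ≤ a) (hκ : 0 ≤ κ) (hs : 0 < s) (hκs : κ * (C * s) = 1)
    (hu : ∫ x, ‖toEuclideanLin (W x) u‖ ^ 2 ∂σ ≤ C) :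
    0 ≤ ∫ x, stoppingDensity ρ W b u a κ s x ∂σ := by
  rw [integral_stoppingDensity hσ hb]
  have h1 := integral_inner_le hσ hb hs hu
  have h2 := jensenDefect_nonneg hσ
  have h3 := logDetDivergence_nonneg hρ.posDef_block hσ.posDef_block
  have h4 : 0 ≤ s⁻¹ * ∫ x, ‖b x‖ ^ 2 ∂σ :=
    mul_nonneg (inv_nonneg.2 hs.le) (integral_nonneg fun x => sq_nonneg _)
  have h5 := mul_nonneg ha (add_nonneg h2 h3)
  have h6 := mul_le_mul_of_nonneg_left (show -(C * s) / 2 ≤ 5 / 8 + s⁻¹ * ∫ x, ‖b x‖ ^ 2 ∂σ -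
    ∫ x, inner ℝ (toEuclideanLin (W x) u) (b x) ∂σ by linarith) hκ
  rw [blockExpectation, blockExpectation] at *
  linarith

/-- The integral equals `(⟨W⟩_σ u, e)` with `e` the weighted average of `b`, and `⟨W⟩_σ u` is close
to `⟨W⟩_ρ u = v`. -/
lemma integral_inner_le_of_close (hρ : IsAInftyOn ρ W K) (hσ : IsAInftyOn σ W K)
    (hb : MemLp b 2 σ) (hv : ‖v‖ = 1) (hu : u = toEuclideanLin (expectation ρ W)⁻¹ v)
    (hε : 0 < ε) (hτ : 0 ≤ τ) (hτ1 : τ ≤ 1) (hτε : 3 * τ * (2 + K) ≤ ε)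
    (h1 : logDetDivergence (blockExpectation ρ W) (blockExpectation σ W) ≤ τ ^ 2)
    (h2 : 4 * ε * ‖weightedExpectation σ W b‖ ≤ 1) :
    ∫ x, inner ℝ (toEuclideanLin (W x) u) (b x) ∂σ ≤
      inner ℝ v (weightedExpectation σ W b) + 1 / 8 := by
  set e := weightedExpectation σ W b with he
  have hAu : toEuclideanLin (expectation ρ W) u = v := by rw [hu]; exact hρ.toEuclideanLin_mul_inv v
  rw [← inner_integral_toEuclideanLin hσ.posDef hσ.memLp hb,
    ← hσ.toEuclideanLin_mul_inv (∫ x, toEuclideanLin (W x) (b x) ∂σ)]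
  change inner ℝ u (toEuclideanLin (expectation σ W) e) ≤ _
  rw [← inner_toEuclideanLin_comm hσ.posDef_expectation.1, real_inner_comm]
  -- Rescaling `e` by `4ε` makes it of norm at most `1`, so the error is at most `3τ(2 + K)/2 ≤
  -- ε/2`; dividing by `4ε` leaves `1/8`.
  have h3 := abs_dotProduct_sub_mulVec_le hρ.posDef_expectation.1 hσ.posDef_expectation.1
    hρ.posDef_block hσ.posDef_block hτ hτ1 h1 ((4 * ε) • e).ofLp u.ofLp
  rw [← inner_toEuclideanLin, ← inner_toEuclideanLin, ← inner_toEuclideanLin, hAu,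
    inner_smul_left, inner_smul_left] at h3
  have h4 := hρ.reverseHolder u.ofLp
  have hself : ∀ w : EuclideanSpace ℝ (Fin N), w.ofLp ⬝ᵥ w.ofLp = ‖w‖ ^ 2 := fun w => by
    rw [← real_inner_self_eq_norm_sq, EuclideanSpace.inner_eq_star_dotProduct, star_trivial]
  have hv' : expectation ρ W *ᵥ u.ofLp ⬝ᵥ expectation ρ W *ᵥ u.ofLp = 1 := by
    have := hself (toEuclideanLin (expectation ρ W) u)
    rw [hAu, hv, ← hAu] at this
    simpa using this
  rw [hv', ← inner_toEuclideanLin] at h4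
  rw [hself, norm_smul, Real.norm_of_nonneg (by positivity)] at h3
  have h5 : (4 * ε * ‖e‖) ^ 2 ≤ 1 := pow_le_one₀ (by positivity) h2
  have h6 := (abs_le.1 h3).2
  simp only [RCLike.conj_to_real] at h6
  have h7 : 3 * τ / 2 * (2 * (4 * ε * ‖e‖) ^ 2 +
      inner ℝ u (toEuclideanLin (expectation ρ fun x => W x ^ 2) u)) ≤ 3 * τ / 2 * (2 + K) :=
    mul_le_mul_of_nonneg_left (by linarith) (by positivity)
  rw [real_inner_comm e v]
  have h8 : 4 * ε * (inner ℝ e (toEuclideanLin (expectation σ W) u) - inner ℝ e v) ≤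
      4 * ε * (1 / 8) := by linarith
  have := le_of_mul_le_mul_left h8 (by positivity)
  linarith

/-- Each stopping reason is paid for by its own term: the divergence by `a`, a large average of `b`
by `s⁻¹|b|²`, a small component along `v` by the constant `5/8`. -/
lemma le_integral_stoppingDensity (hρ : IsAInftyOn ρ W K) (hσ : IsAInftyOn σ W K)
    (hb : MemLp b 2 σ) (hv : ‖v‖ = 1) (hu : u = toEuclideanLin (expectation ρ W)⁻¹ v)
    (ha : a * τ ^ 2 = 1) (hκ : 0 ≤ κ) (hs : 0 < s) (hκs : κ * (C * s) = 1)
    (hε : 0 < ε) (hεs : 16 * ε ^ 2 * (C * K * s ^ 2) ≤ 1) (hτ : 0 < τ) (hτ1 : τ ≤ 1)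
    (hτε : 3 * τ * (2 + K) ≤ ε)
    (hC : ∫ x, ‖toEuclideanLin (W x) u‖ ^ 2 ∂σ ≤ C) (hbad : IsStopping ρ σ W b v τ ε) :
    1 + a * jensenDefect σ W ≤ ∫ x, stoppingDensity ρ W b u a κ s x ∂σ := by
  rw [integral_stoppingDensity hσ hb]
  have ha0 : 0 ≤ a := by
    by_contra! h
    nlinarith [sq_nonneg τ]
  have h1 := integral_inner_le hσ hb hs hC
  have h3 : 0 ≤ logDetDivergence (blockExpectation ρ W) (blockExpectation σ W) :=
    logDetDivergence_nonneg hρ.posDef_block hσ.posDef_block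
  have h4 : 0 ≤ s⁻¹ * ∫ x, ‖b x‖ ^ 2 ∂σ :=
    mul_nonneg (inv_nonneg.2 hs.le) (integral_nonneg fun x => sq_nonneg _)
  have h5 := mul_nonneg ha0 h3
  by_cases hW : τ ^ 2 < logDetDivergence (blockExpectation ρ W) (blockExpectation σ W)
  -- The divergence contributes at least `a τ² = 1`, more than the possible loss `κ C s / 2 = 1/2`.
  · have h6 := mul_le_mul_of_nonneg_left (show -(C * s) / 2 ≤ 5 / 8 + s⁻¹ * ∫ x, ‖b x‖ ^ 2 ∂σ -
      ∫ x, inner ℝ (toEuclideanLin (W x) u) (b x) ∂σ by linarith) hκ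
    have h7 := mul_le_mul_of_nonneg_left hW.le ha0
    linarith
  have key : ∫ x, inner ℝ (toEuclideanLin (W x) u) (b x) ∂σ ≤
      5 / 8 + s⁻¹ * ∫ x, ‖b x‖ ^ 2 ∂σ := by
    by_cases hE : 1 < 4 * ε * ‖weightedExpectation σ W b‖
    · have h6 : ‖weightedExpectation σ W b‖ ^ 2 ≤ K * ∫ x, ‖b x‖ ^ 2 ∂σ :=
        hσ.norm_weighted_expectation_sq_le hb
      have h7 : 1 ≤ (4 * ε * ‖weightedExpectation σ W b‖) ^ 2 := one_le_pow₀ hE.le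
      have hC0 : 0 ≤ C := (integral_nonneg fun x => sq_nonneg _).trans hC
      have hβ : 0 ≤ ∫ x, ‖b x‖ ^ 2 ∂σ := integral_nonneg fun x => sq_nonneg _
      -- A large average forces `⟨|b|²⟩` to be large; the choice of `ε` then makes it dominate both
      -- halves of the Young bound `h1`.
      have h8 : s * C ≤ s⁻¹ * ∫ x, ‖b x‖ ^ 2 ∂σ := by
        calc s * C ≤ s * C * (16 * ε ^ 2 * (K * ∫ x, ‖b x‖ ^ 2 ∂σ)) := by
              refine le_mul_of_one_le_right (by positivity) (h7.trans ?_)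
              rw [mul_pow, mul_pow]
              nlinarith [sq_nonneg ε]
          _ = (16 * ε ^ 2 * (C * K * s ^ 2)) * (s⁻¹ * ∫ x, ‖b x‖ ^ 2 ∂σ) := by field_simp
          _ ≤ 1 * (s⁻¹ * ∫ x, ‖b x‖ ^ 2 ∂σ) := mul_le_mul_of_nonneg_right hεs h4
          _ = _ := one_mul _
      linarith
    -- Here `(v, e) < 1/2`, and `1/2 + 1/8 = 5/8`.
    · have h6 := integral_inner_le_of_close hρ hσ hb hv hu hε hτ.le hτ1 hτε (not_lt.1 hW)
        (not_lt.1 hE)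
      have h7 : inner ℝ v (weightedExpectation σ W b) < 1 / 2 := by
        rcases hbad with h | h | h
        · exact absurd h hW
        · exact absurd h hE
        · exact h
      linarith
  have := mul_nonneg hκ (sub_nonneg.2 key)
  linarith

lemma integral_norm_sq_root_le (hρ : IsAInftyOn ρ W K) (hv : ‖v‖ = 1)
    (hu : u = toEuclideanLin (expectation ρ W)⁻¹ v) :
    ∫ x, ‖toEuclideanLin (W x) u‖ ^ 2 ∂ρ ≤ K := by
  have h := hρ.integral_norm_sq_le u
  rwa [hu, hρ.toEuclideanLin_mul_inv, hv, one_pow, mul_one, ← hu] at h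

/-- Small divergence keeps `⟨W²⟩_σ` below `(1 + 3τ) ⟨W²⟩_ρ ≤ 2 ⟨W²⟩_ρ`. Together with doubling, this
gives the bound `C` on every child of a non-stopping cube, stopping or not. -/
lemma integral_norm_sq_le_of_not_isStopping (hρ : IsAInftyOn ρ W K) (hσ : IsAInftyOn σ W K)
    (hv : ‖v‖ = 1) (hu : u = toEuclideanLin (expectation ρ W)⁻¹ v) (hτ : 0 ≤ τ) (hτ1 : τ ≤ 1 / 3)
    (hbad : ¬ IsStopping ρ σ W b v τ ε) :
    ∫ x, ‖toEuclideanLin (W x) u‖ ^ 2 ∂σ ≤ 2 * K := by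
  have hsq : ∀ {ν : Measure α} [IsProbabilityMeasure ν], IsAInftyOn ν W K →
      ∫ x, ‖toEuclideanLin (W x) u‖ ^ 2 ∂ν =
        u.ofLp ⬝ᵥ (expectation ν fun x => W x ^ 2) *ᵥ u.ofLp := fun {ν} _ hν => by
    rw [dotProduct_expectation_mulVec hν.integrable_sq]
    refine integral_congr_ae ?_
    filter_upwards [hν.posDef] with x hx
    exact norm_toEuclideanLin_sq hx.1 u
  have h1 := quadForm_le_of_logDetDivergence_le hρ.posDef_expectation.1 hσ.posDef_expectation.1
    hρ.posDef_block hσ.posDef_block hτ (by linarith) (not_lt.1 fun h => hbad (Or.inl h)) u.ofLp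
  rw [← hsq hσ, ← hsq hρ] at h1
  have h2 := integral_norm_sq_root_le hρ hv hu
  have h3 : 0 ≤ ∫ x, ‖toEuclideanLin (W x) u‖ ^ 2 ∂ρ := integral_nonneg fun x => sq_nonneg _
  nlinarith

lemma not_isStopping_root (hρ : IsAInftyOn ρ W K) (hb : MemLp b 2 ρ)
    (hvb : inner ℝ v (weightedExpectation ρ W b) = 1) {β : ℝ} (hβ : ∫ x, ‖b x‖ ^ 2 ∂ρ ≤ β)
    (hεβ : 16 * ε ^ 2 * (K * β) ≤ 1) : ¬ IsStopping ρ ρ W b v τ ε := by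
  rintro (h | h | h)
  · rw [logDetDivergence_self (S := blockExpectation ρ W) hρ.posDef_block] at h
    exact absurd h (not_lt.2 (sq_nonneg τ))
  · have h1 : ‖weightedExpectation ρ W b‖ ^ 2 ≤ K * ∫ x, ‖b x‖ ^ 2 ∂ρ :=
      hρ.norm_weighted_expectation_sq_le hb
    have h2 : 1 < (4 * ε * ‖weightedExpectation ρ W b‖) ^ 2 := one_lt_pow₀ h two_ne_zero
    have h3 := mul_le_mul_of_nonneg_left hβ hρ.pos.le
    have h4 := mul_le_mul_of_nonneg_left (h1.trans h3) (show 0 ≤ 16 * ε ^ 2 by positivity)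
    nlinarith
  · rw [hvb] at h; norm_num at h

/-- At the root the divergence vanishes and the inner product integrates to `1`, so the bracket is
at most `5/8 + 1/8 - 1 = -1/4`. -/
lemma integral_stoppingDensity_root_le (hρ : IsAInftyOn ρ W K) (hb : MemLp b 2 ρ)
    (hu : u = toEuclideanLin (expectation ρ W)⁻¹ v)
    (hvb : inner ℝ v (weightedExpectation ρ W b) = 1) (hs : 0 < s) (hκ : 0 ≤ κ)
    (hβ : 8 * ∫ x, ‖b x‖ ^ 2 ∂ρ ≤ s) :
    ∫ x, stoppingDensity ρ W b u a κ s x ∂ρ ≤ 1 + a * jensenDefect ρ W - κ / 4 := by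
  rw [integral_stoppingDensity hρ hb,
    logDetDivergence_self (S := blockExpectation ρ W) hρ.posDef_block,
    ← inner_integral_toEuclideanLin hρ.posDef hρ.memLp hb, hu,
    inner_toEuclideanLin_comm hρ.posDef_expectation.inv.1]
  change 1 + a * (jensenDefect ρ W + 0) + κ * (5 / 8 + s⁻¹ * ∫ x, ‖b x‖ ^ 2 ∂ρ -
    inner ℝ v (weightedExpectation ρ W b)) ≤ _
  have h1 : s⁻¹ * ∫ x, ‖b x‖ ^ 2 ∂ρ ≤ 1 / 8 := by
    rw [inv_mul_le_iff₀ hs]; linarith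
  have h2 := mul_le_mul_of_nonneg_left h1 hκ
  rw [hvb]
  linarith

end Stopping

end LocalTb

namespace LocalTb

open Matrix

/-! ### Stopping time induction over dyadic scales -/

section Induction

variable {n : ℕ}

/-- The part of the Carleson box of the cube `(k, m)` above height `2 ^ (k - j)`. -/
def strip (j : ℕ) (k : ℤ) (m : Fin n → ℤ) : Set (ℝ × (Fin n → ℝ)) :=
  Set.Ioc ((2 : ℝ) ^ (k - j)) (2 ^ k) ×ˢ dyadicCube k m

/-- Descending from a cube, each Whitney region above the stopping cubes is charged to `G` and each
stopping cube to its own `L`. Additivity of `L` over children reassembles the charges, so no family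
of stopping cubes has to be selected explicitly. -/
lemma stopping_time_induction (Θ : Measure (ℝ × (Fin n → ℝ))) (f G : ℝ × (Fin n → ℝ) → ℝ≥0∞)
    (H bad : ℤ → (Fin n → ℤ) → Prop) (L : ℤ → (Fin n → ℤ) → ℝ) (j : ℕ)
    (hL : ∀ k m, H k m → 0 ≤ L k m)
    (hsplit : ∀ k m, L k m = ∑ e, L (k - 1) (childIndex m e))
    (hchild : ∀ k m, H k m → ¬ bad k m → ∀ e, H (k - 1) (childIndex m e))
    (hwhitney : ∀ k m, ¬ bad k m → ∀ p ∈ Set.Ioc ((2 : ℝ) ^ (k - 1)) (2 ^ k) ×ˢ dyadicCube k m,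
      f p ≤ G p)
    (hbad : ∀ i < j, ∀ k m, H k m → bad k m →
      ∫⁻ p in strip i k m, f p ∂Θ ≤ ENNReal.ofReal (L k m)) :
    -- At full height `i = j` no bound for bad cubes is available yet, so there the cube must be
    -- non-stopping; proper descendants have smaller height.
    ∀ i ≤ j, ∀ k m, H k m → (i = j → ¬ bad k m) → ∫⁻ p in strip i k m, f p ∂Θ ≤
      ∫⁻ p in Set.Ioc 0 (2 ^ k) ×ˢ dyadicCube k m, G p ∂Θ + ENNReal.ofReal (L k m) := by
  intro i
  induction i with
  | zero =>
    intro _ k m _ _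
    simp [strip]
  | succ i ih =>
    intro hi k m hH hns
    by_cases hs : bad k m
    · exact (hbad _ (lt_of_le_of_ne hi fun h => hns h hs) k m hH hs).trans le_add_self
    have h1 : (2 : ℝ) ^ (k - ((i + 1 : ℕ) : ℤ)) ≤ 2 ^ (k - 1) :=
      zpow_le_zpow_right₀ one_le_two (by push_cast; omega)
    rw [strip, lintegral_dyadic_split Θ f k m h1,
      lintegral_dyadic_split Θ G k m (by positivity : (0 : ℝ) ≤ 2 ^ (k - 1)), hsplit k m,
      ENNReal.ofReal_sum_of_nonneg fun e _ => hL _ _ (hchild k m hH hs e), add_assoc,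
      ← Finset.sum_add_distrib]
    refine add_le_add (setLIntegral_mono' (measurableSet_Ioc.prod (measurableSet_dyadicCube _ _))
      (hwhitney k m hs)) (Finset.sum_le_sum fun e _ => ?_)
    have := ih (by omega) (k - 1) (childIndex m e) (hchild k m hH hs e) (by omega)
    rwa [strip, show k - 1 - (i : ℤ) = k - ((i + 1 : ℕ) : ℤ) by push_cast; ring] at this

end Induction

/-! ### The local `Tb` argument in one direction -/

section OneDirection

variable {n N M : ℕ} {μ : Measure (Fin n → ℝ)} {W : (Fin n → ℝ) → Matrix (Fin N) (Fin N) ℝ}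

lemma integral_norm_sq_cubeMeasure_le {Q : Set (Fin n → ℝ)} (h0 : μ Q ≠ 0) (h1 : μ Q ≠ ∞)
    {b : (Fin n → ℝ) → EuclideanSpace ℝ (Fin N)} (hb : MemLp b 2 μ) {C : ℝ≥0}
    (hC : ∫⁻ x, ‖b x‖ₑ ^ 2 ∂μ ≤ (C : ℝ≥0∞) ^ 2 * μ Q) :
    ∫ x, ‖b x‖ ^ 2 ∂cubeMeasure μ Q ≤ (C : ℝ) ^ 2 := by
  have hV : 0 < μ.real Q := ENNReal.toReal_pos h0 h1
  have h2 : ∫ x in Q, ‖b x‖ ^ 2 ∂μ ≤ (C : ℝ) ^ 2 * μ.real Q := by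
    rw [integral_eq_lintegral_of_nonneg_ae (.of_forall fun x => sq_nonneg _)
      (hb.1.norm.pow 2).restrict]
    refine ENNReal.toReal_le_of_le_ofReal (by positivity) ?_
    rw [ENNReal.ofReal_mul (by positivity), measureReal_def, ENNReal.ofReal_toReal h1,
      ENNReal.ofReal_pow (by positivity), ENNReal.ofReal_coe_nnreal]
    refine le_trans (le_trans ?_ (setLIntegral_le_lintegral Q _)) hC
    refine lintegral_mono fun x => ?_
    rw [ENNReal.ofReal_pow (norm_nonneg _), ofReal_norm]
  rw [setIntegral_eq_smul h1, smul_eq_mul, mul_comm] at h2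
  exact le_of_mul_le_mul_right h2 hV

lemma setIntegral_norm_sq_child_le {C₁ : ℝ≥0} (hμ : IsDoublingWith μ C₁) {K : ℝ}
    (hA : ∀ k m, IsAInftyOn (cubeMeasure μ (dyadicCube k m)) W K)
    (h0 : ∀ (k : ℤ) (m : Fin n → ℤ), μ (dyadicCube k m) ≠ 0) {k : ℤ} {m : Fin n → ℤ}
    (e : Fin n → Fin 2) {u : EuclideanSpace ℝ (Fin N)} {R : ℝ}
    (hu : ∫ x, ‖toEuclideanLin (W x) u‖ ^ 2 ∂cubeMeasure μ (dyadicCube k m) ≤ R) :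
    ∫ x, ‖toEuclideanLin (W x) u‖ ^ 2 ∂cubeMeasure μ (dyadicCube (k - 1) (childIndex m e)) ≤
      R * C₁ ^ 2 := by
  have hfin : ∀ (k : ℤ) (m : Fin n → ℤ), μ (dyadicCube k m) ≠ ∞ := fun k m =>
    (measure_dyadicCube_lt_top hμ k m).ne
  have hV : 0 < μ.real (dyadicCube (k - 1) (childIndex m e)) :=
    ENNReal.toReal_pos (h0 _ _) (hfin _ _)
  have hint : IntegrableOn (fun x => ‖toEuclideanLin (W x) u‖ ^ 2) (dyadicCube k m) μ := by
    have := integrable_norm_toEuclideanLin_sq (hA k m).posDef (hA k m).integrable_sq u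
    rwa [cubeMeasure, integrable_smul_measure (by simpa using hfin k m)
      (inv_restrict_univ_ne_top (h0 k m))] at this
  have h1 := setIntegral_mono_set hint (.of_forall fun x => sq_nonneg _)
    (dyadicCube_child_subset k m e).eventuallyLE
  rw [setIntegral_eq_smul (hfin _ _), setIntegral_eq_smul (hfin _ _), smul_eq_mul,
    smul_eq_mul] at h1
  have h2 : μ.real (dyadicCube k m) ≤
      (C₁ : ℝ) ^ 2 * μ.real (dyadicCube (k - 1) (childIndex m e)) := by
    have := ENNReal.toReal_mono (ENNReal.mul_ne_top (by simp) (hfin _ _))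
      (measure_dyadicCube_le_child hμ k m e)
    simpa [measureReal_def] using this
  have hR : 0 ≤ R := (integral_nonneg fun x => sq_nonneg _).trans hu
  have h3 : μ.real (dyadicCube k m) *
      ∫ x, ‖toEuclideanLin (W x) u‖ ^ 2 ∂cubeMeasure μ (dyadicCube k m) ≤
      ((C₁ : ℝ) ^ 2 * μ.real (dyadicCube (k - 1) (childIndex m e))) * R :=
    mul_le_mul h2 hu (integral_nonneg fun x => sq_nonneg _) (by positivity)
  refine le_of_mul_le_mul_left (h1.trans (h3.trans (le_of_eq ?_))) hV
  ring

/-- The local `Tb` argument for operators which are almost extremal in one direction `v`. -/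
lemma exists_lintegral_strip_le {C₁ : ℝ≥0} (hμ : IsDoublingWith μ C₁) {K : ℝ}
    (hA : ∀ k m, IsAInftyOn (cubeMeasure μ (dyadicCube k m)) W K)
    (h0 : ∀ (k : ℤ) (m : Fin n → ℤ), μ (dyadicCube k m) ≠ 0)
    (Θ : Measure (ℝ × (Fin n → ℝ)))
    (γ : ℝ × (Fin n → ℝ) → (EuclideanSpace ℝ (Fin N) →L[ℝ] EuclideanSpace ℝ (Fin M)))
    {C₃ C₄ : ℝ≥0} {C s ε τ : ℝ} (hK : 1 ≤ K) (hC : 2 * K * (C₁ ^ 2 + 1) ≤ C)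
    (hs : 8 * (C₃ : ℝ) ^ 2 + 1 ≤ s) (hε : 0 < ε) (hεs : 16 * ε ^ 2 * (C * K * s ^ 2) ≤ 1)
    (hτ : 0 < τ) (hτ1 : τ ≤ 1 / 3) (hτε : 3 * τ * (2 + K) ≤ ε)
    {v : EuclideanSpace ℝ (Fin N)} (hv : ‖v‖ = 1)
    (hb : ∀ (k : ℤ) (m : Fin n → ℤ), ∃ b : (Fin n → ℝ) → EuclideanSpace ℝ (Fin N),
      MemLp b 2 μ ∧ inner ℝ v (weightedAverage μ W (dyadicCube k m) b) = 1 ∧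
      ∫⁻ x, ‖b x‖ₑ ^ 2 ∂μ ≤ (C₃ : ℝ≥0∞) ^ 2 * μ (dyadicCube k m) ∧
      ∫⁻ p, ‖γ p (averagingOperator μ W p.1 b p.2)‖ₑ ^ 2 ∂Θ
        ≤ (C₄ : ℝ≥0∞) ^ 2 * μ (dyadicCube k m))
    (f : ℝ × (Fin n → ℝ) → ℝ≥0∞)
    (hf : ∀ p e, 1 / 2 ≤ inner ℝ v e → 4 * ε * ‖e‖ ≤ 1 → f p ≤ 16 * ‖γ p e‖ₑ ^ 2) :
    ∃ Λ : ℝ≥0, ∀ j k m, ∫⁻ p in strip j k m, f p ∂Θ ≤ Λ * μ (dyadicCube k m) := by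
  have hfin : ∀ (k : ℤ) (m : Fin n → ℤ), μ (dyadicCube k m) ≠ ∞ := fun k m =>
    (measure_dyadicCube_lt_top hμ k m).ne
  have hprob : ∀ (k : ℤ) (m : Fin n → ℤ), IsProbabilityMeasure (cubeMeasure μ (dyadicCube k m)) :=
    fun k m => isProbabilityMeasure_cubeMeasure (h0 k m) (hfin k m)
  have hV : ∀ (k : ℤ) (m : Fin n → ℤ), 0 < μ.real (dyadicCube k m) := fun k m =>
    ENNReal.toReal_pos (h0 k m) (hfin k m)
  have hs1 : 1 ≤ s := by linarith [sq_nonneg (C₃ : ℝ)]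
  have hs0 : 0 < s := by linarith
  have hKC : K ≤ C := by nlinarith [sq_nonneg (C₁ : ℝ)]
  have hC0 : 0 < C := by linarith
  set κ : ℝ := (C * s)⁻¹ with hκdef
  have hκ : 0 < κ := by positivity
  have hκs : κ * (C * s) = 1 := inv_mul_cancel₀ (by positivity)
  set a : ℝ := (τ ^ 2)⁻¹ with hadef
  have ha : a * τ ^ 2 = 1 := inv_mul_cancel₀ (by positivity)
  have ha0 : 0 < a := by positivity
  -- Chosen so that the gain `Λ κ / 4` at the root equals the cost `16 C₄²` of the non-stopping
  -- region.
  set Λ : ℝ := 64 * (C₄ : ℝ) ^ 2 / κ with hΛdef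
  have hΛ0 : 0 ≤ Λ := by positivity
  have hΛ : Λ * κ = 64 * (C₄ : ℝ) ^ 2 := div_mul_cancel₀ _ hκ.ne'
  -- Keeping the defect in the bound is what lets the induction close with the same `Λ` at every
  -- scale; the defect is replaced by its uniform bound only afterwards.
  have main : ∀ (j : ℕ) (k : ℤ) (m : Fin n → ℤ), ∫⁻ p in strip j k m, f p ∂Θ ≤
      ENNReal.ofReal (Λ * (μ.real (dyadicCube k m) *
        (1 + a * jensenDefect (cubeMeasure μ (dyadicCube k m)) W))) := by
    intro j
    induction j using Nat.strong_induction_on with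
    | _ j ih =>
    intro k₀ m₀
    obtain ⟨b, hbL, hb1, hb2, hb3⟩ := hb k₀ m₀
    have hbR : ∀ (k : ℤ) (m : Fin n → ℤ), MemLp b 2 (cubeMeasure μ (dyadicCube k m)) :=
      fun k m => (hbL.restrict _).smul_measure (inv_restrict_univ_ne_top (h0 k m))
    have hE : ∀ (k : ℤ) (m : Fin n → ℤ), weightedAverage μ W (dyadicCube k m) b =
        weightedExpectation (cubeMeasure μ (dyadicCube k m)) W b := fun k m =>
      weightedAverage_eq (h0 k m) (hfin k m) W (hA k m).posDef_expectation b
    set ρ := cubeMeasure μ (dyadicCube k₀ m₀) with hρdef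
    have hρA : IsAInftyOn ρ W K := hA k₀ m₀
    set u := toEuclideanLin (expectation ρ W)⁻¹ v with hu
    have hβ : ∫ x, ‖b x‖ ^ 2 ∂ρ ≤ (C₃ : ℝ) ^ 2 :=
      integral_norm_sq_cubeMeasure_le (h0 k₀ m₀) (hfin k₀ m₀) hbL hb2
    have hroot : ¬ IsStopping ρ ρ W b v τ ε := by
      refine not_isStopping_root hρA (hbR k₀ m₀) (by rw [← hE, hb1]) hβ ?_
      refine le_trans ?_ hεs
      have h1 : (C₃ : ℝ) ^ 2 ≤ C * s ^ 2 := by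
        have h2 : s ≤ s ^ 2 := le_self_pow₀ hs1 two_ne_zero
        have h3 : s ^ 2 ≤ C * s ^ 2 := le_mul_of_one_le_left (sq_nonneg s) (hK.trans hKC)
        linarith [sq_nonneg (C₃ : ℝ)]
      have := mul_le_mul_of_nonneg_left h1 (show 0 ≤ 16 * ε ^ 2 * K by positivity)
      linarith
    have hgint : ∀ (k : ℤ) (m : Fin n → ℤ),
        IntegrableOn (stoppingDensity ρ W b u a κ s) (dyadicCube k m) μ := by
      intro k m
      have := integrable_stoppingDensity (hA k m) (hbR k m) ρ u a κ s
      rwa [cubeMeasure, integrable_smul_measure (by simpa using hfin k m)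
        (inv_restrict_univ_ne_top (h0 k m))] at this
    have hgR : ∀ (k : ℤ) (m : Fin n → ℤ), ∫ x in dyadicCube k m, stoppingDensity ρ W b u a κ s x ∂μ
        = μ.real (dyadicCube k m) *
          ∫ x, stoppingDensity ρ W b u a κ s x ∂cubeMeasure μ (dyadicCube k m) :=
      fun k m => setIntegral_eq_smul (hfin k m) _
    have key := stopping_time_induction Θ f
      (fun p => 16 * ‖γ p (averagingOperator μ W p.1 b p.2)‖ₑ ^ 2)
      (fun k m => ∫ x, ‖toEuclideanLin (W x) u‖ ^ 2 ∂cubeMeasure μ (dyadicCube k m) ≤ C)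
      (fun k m => IsStopping ρ (cubeMeasure μ (dyadicCube k m)) W b v τ ε)
      (fun k m => Λ * ∫ x in dyadicCube k m, stoppingDensity ρ W b u a κ s x ∂μ) j ?_ ?_ ?_ ?_ ?_
      j le_rfl k₀ m₀ ?_ fun _ => hroot
    · refine key.trans ?_
      have h1 : ∫⁻ p in Set.Ioc 0 (2 ^ k₀) ×ˢ dyadicCube k₀ m₀,
          16 * ‖γ p (averagingOperator μ W p.1 b p.2)‖ₑ ^ 2 ∂Θ ≤
          ENNReal.ofReal (16 * (C₄ : ℝ) ^ 2 * μ.real (dyadicCube k₀ m₀)) := by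
        refine (setLIntegral_le_lintegral _ _).trans ?_
        rw [lintegral_const_mul' _ _ (by norm_num), mul_assoc, ENNReal.ofReal_mul (by norm_num),
          ENNReal.ofReal_mul (by positivity), measureReal_def, ENNReal.ofReal_toReal (hfin _ _),
          ENNReal.ofReal_pow (by positivity), ENNReal.ofReal_coe_nnreal]
        gcongr
        norm_num
      have h2 := integral_stoppingDensity_root_le (κ := κ) (a := a) hρA (hbR k₀ m₀) hu
        (by rw [← hE, hb1]) hs0 hκ.le (by linarith)
      refine (add_le_add_left h1 _).trans ?_
      have h3 := integral_stoppingDensity_nonneg (ρ := ρ) (κ := κ) (C := C) hρA (hA k₀ m₀)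
        (hbR k₀ m₀) ha0.le hκ.le hs0 hκs
        ((integral_norm_sq_root_le hρA hv hu).trans hKC)
      rw [hgR, ← ENNReal.ofReal_add (by positivity)
        (mul_nonneg hΛ0 (mul_nonneg (hV _ _).le h3))]
      refine ENNReal.ofReal_le_ofReal ?_
      have h4 := mul_le_mul_of_nonneg_left h2 (mul_nonneg hΛ0 (hV k₀ m₀).le)
      have h5 : Λ * μ.real (dyadicCube k₀ m₀) * (κ / 4) =
          16 * (C₄ : ℝ) ^ 2 * μ.real (dyadicCube k₀ m₀) := by
        linear_combination (μ.real (dyadicCube k₀ m₀) / 4) * hΛ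
      linarith
    · intro k m hH
      rw [hgR]
      exact mul_nonneg hΛ0 (mul_nonneg (hV k m).le
        (integral_stoppingDensity_nonneg hρA (hA k m) (hbR k m) ha0.le hκ.le hs0 hκs hH))
    · intro k m
      rw [← Finset.mul_sum, integral_dyadic_split (hgint k m)]
    · intro k m hH hns e
      refine (setIntegral_norm_sq_child_le hμ hA h0 e (integral_norm_sq_le_of_not_isStopping hρA
        (hA k m) hv hu hτ.le hτ1 hns)).trans ?_
      nlinarith
    · rintro k m hns ⟨t, x⟩ ⟨ht, hx⟩
      simp only [IsStopping, not_or, not_lt] at hns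
      refine hf _ _ ?_ ?_
      · rw [averagingOperator, dyadicCubeAt_eq ht hx, hE]
        exact hns.2.2
      · rw [averagingOperator, dyadicCubeAt_eq ht hx, hE]
        exact hns.2.1
    · intro i hi k m hH hbad
      refine (ih i hi k m).trans (ENNReal.ofReal_le_ofReal (mul_le_mul_of_nonneg_left ?_ hΛ0))
      rw [hgR]
      exact mul_le_mul_of_nonneg_left (le_integral_stoppingDensity hρA (hA k m) (hbR k m) hv hu ha
        hκ.le hs0 hκs hε hεs hτ (by linarith) hτε hH hbad) (hV k m).le
    · exact (integral_norm_sq_root_le hρA hv hu).trans hKC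
  refine ⟨(Λ * (1 + a * (N * Real.log 2 + Real.log K))).toNNReal, fun j k m =>
    (main j k m).trans ?_⟩
  rw [← ENNReal.ofReal, ← ENNReal.ofReal_toReal (hfin k m), ← measureReal_def,
    ← ENNReal.ofReal_mul]
  · refine ENNReal.ofReal_le_ofReal ?_
    have h1 := mul_le_mul_of_nonneg_left (jensenDefect_le (hA k m)) ha0.le
    have h2 := mul_le_mul_of_nonneg_left h1 (mul_nonneg hΛ0 (hV k m).le)
    linarith
  · have := Real.log_nonneg hK
    have := Real.log_nonneg one_le_two
    positivity

end OneDirection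

end LocalTb

namespace LocalTb

/-! ### From truncated to full Carleson boxes -/

section CarlesonBox

variable {n : ℕ}

lemma lintegral_carlesonBox_le (Θ : Measure (ℝ × (Fin n → ℝ))) (f : ℝ × (Fin n → ℝ) → ℝ≥0∞)
    (k : ℤ) (m : Fin n → ℤ) {R : ℝ≥0∞} (hR : ∀ j, ∫⁻ p in strip j k m, f p ∂Θ ≤ R) :
    ∫⁻ p in carlesonBox k m, f p ∂Θ ≤ R := by
  have hmono : Monotone fun j => strip j k m := fun i j hij =>
    Set.prod_mono_left (Set.Ioc_subset_Ioc_left (zpow_le_zpow_right₀ one_le_two (by omega)))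
  have hsub : carlesonBox k m ⊆ ⋃ j, strip j k m := by
    rintro ⟨t, x⟩ ⟨ht, hx⟩
    obtain ⟨j, hj⟩ := exists_pow_lt_of_lt_one (y := (1 / 2 : ℝ))
      (show 0 < t / (2 : ℝ) ^ k from div_pos ht.1 (by positivity)) (by norm_num)
    refine Set.mem_iUnion.2 ⟨j, ⟨?_, ht.2.le⟩, hx⟩
    rw [lt_div_iff₀ (by positivity)] at hj
    refine lt_of_eq_of_lt ?_ hj
    rw [zpow_sub₀ two_ne_zero, zpow_natCast, one_div, inv_pow]
    ring
  refine (lintegral_mono_set hsub).trans ?_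
  rw [setLIntegral_iUnion_of_directed f hmono.directed_le]
  exact iSup_le hR

end CarlesonBox

section Cone

variable {E F : Type*} [NormedAddCommGroup E] [InnerProductSpace ℝ E]
  [NormedAddCommGroup F] [InnerProductSpace ℝ F]

/-- Here `(v, e) - ε|e| ≥ 1/2 - 1/4`, whence the factor `4² = 16`. -/
lemma enorm_sq_le_of_mem_directionCone {v : E} {ε : ℝ} {A : E →L[ℝ] F}
    (hA : A ∈ directionCone F v ε) {e : E} (h1 : 1 / 2 ≤ inner ℝ v e) (h2 : 4 * ε * ‖e‖ ≤ 1) :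
    ‖A‖ₑ ^ 2 ≤ 16 * ‖A e‖ₑ ^ 2 := by
  have h3 : ‖A‖ * (1 / 4) ≤ ‖A e‖ :=
    (mul_le_mul_of_nonneg_left (by linarith) (norm_nonneg _)).trans (hA e)
  have h4 : ‖A‖ ≤ 4 * ‖A e‖ := by linarith
  have h5 : ‖A‖ₑ ≤ 4 * ‖A e‖ₑ := by
    rw [← ofReal_norm, ← ofReal_norm, ← ENNReal.ofReal_ofNat 4, ← ENNReal.ofReal_mul (by norm_num)]
    exact ENNReal.ofReal_le_ofReal h4
  calc ‖A‖ₑ ^ 2 ≤ (4 * ‖A e‖ₑ) ^ 2 := by gcongr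
    _ = 16 * ‖A e‖ₑ ^ 2 := by rw [mul_pow]; norm_num

end Cone

end LocalTb

/-! ### Choice of constants and summation over directions -/

theorem theorem1p1 (n N M : ℕ) (hn : 1 ≤ n) (hN : 1 ≤ N) (hM : 1 ≤ M)
    (μ : Measure (Fin n → ℝ)) (C₁ : ℝ≥0) (hμ : LocalTb.IsDoublingWith μ C₁)
    (W : (Fin n → ℝ) → Matrix (Fin N) (Fin N) ℝ) (hW : LocalTb.IsMatrixWeight μ W)
    (C₂ : ℝ) (hWA : LocalTb.IsMatrixAInfty μ (fun x => W x ^ 2) (C₂ ^ 2))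
    (γ : ℝ × (Fin n → ℝ) → (EuclideanSpace ℝ (Fin N) →L[ℝ] EuclideanSpace ℝ (Fin M)))
    (hγ : AEStronglyMeasurable γ (LocalTb.halfSpaceMeasure μ))
    (C₃ C₄ : ℝ≥0)
    (hb : ∀ (k : ℤ) (m : Fin n → ℤ) (v : EuclideanSpace ℝ (Fin N)), ‖v‖ = 1 →
      ∃ b : (Fin n → ℝ) → EuclideanSpace ℝ (Fin N),
        MemLp b 2 μ ∧
        inner ℝ v (LocalTb.weightedAverage μ W (LocalTb.dyadicCube k m) b) = 1 ∧
        ∫⁻ x, ‖b x‖ₑ ^ 2 ∂μ ≤ (C₃ : ℝ≥0∞) ^ 2 * μ (LocalTb.dyadicCube k m) ∧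
        ∫⁻ p, ‖γ p (LocalTb.averagingOperator μ W p.1 b p.2)‖ₑ ^ 2 ∂(LocalTb.halfSpaceMeasure μ)
          ≤ (C₄ : ℝ≥0∞) ^ 2 * μ (LocalTb.dyadicCube k m)) :
    (⨆ (k : ℤ) (m : Fin n → ℤ),
      (μ (LocalTb.dyadicCube k m))⁻¹ *
        ∫⁻ p in LocalTb.carlesonBox k m, ‖γ p‖ₑ ^ 2 ∂(LocalTb.halfSpaceMeasure μ)) < ∞ := by
  classical
  -- On a null cube every weighted average is `0`, contradicting `(v, E_Q b) = 1`.
  have h0 : ∀ (k : ℤ) (m : Fin n → ℤ), μ (LocalTb.dyadicCube k m) ≠ 0 := by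
    intro k m h
    obtain ⟨b, -, hb1, -⟩ := hb k m (EuclideanSpace.single ⟨0, hN⟩ 1) (by simp)
    simp [LocalTb.weightedAverage, Measure.restrict_eq_zero.2 h] at hb1
  -- The added `1` gives `K ≥ 1`, hence `log K ≥ 0`.
  set K : ℝ := C₂ ^ 2 + 1 with hKdef
  have hK : 1 ≤ K := by linarith [sq_nonneg C₂]
  have hA : ∀ k m, LocalTb.IsAInftyOn (LocalTb.cubeMeasure μ (LocalTb.dyadicCube k m)) W K :=
    fun k m => LocalTb.isAInftyOn_cubeMeasure hW hWA (by linarith) (h0 k m)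
  set C : ℝ := 2 * K * (C₁ ^ 2 + 1) with hCdef
  set s : ℝ := 8 * (C₃ : ℝ) ^ 2 + 1 with hsdef
  have hX : 0 ≤ C * K * s ^ 2 := by positivity
  set ε : ℝ := 1 / (4 * (1 + C * K * s ^ 2)) with hεdef
  have hε : 0 < ε := by positivity
  have hε1 : ε * (4 * (1 + C * K * s ^ 2)) = 1 := one_div_mul_cancel (by positivity)
  have hε4 : ε ≤ 1 / 4 := by nlinarith
  have hεs : 16 * ε ^ 2 * (C * K * s ^ 2) ≤ 1 := by
    calc 16 * ε ^ 2 * (C * K * s ^ 2) ≤ 16 * ε ^ 2 * (1 + C * K * s ^ 2) ^ 2 := by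
          gcongr; nlinarith
      _ = (ε * (4 * (1 + C * K * s ^ 2))) ^ 2 := by ring
      _ ≤ 1 := by rw [hε1]; norm_num
  set τ : ℝ := ε / (3 * (2 + K)) with hτdef
  have hτ : 0 < τ := by positivity
  have hτε : 3 * τ * (2 + K) = ε := by rw [hτdef]; field_simp
  have hτ1 : τ ≤ 1 / 3 := by nlinarith
  have : Nontrivial (EuclideanSpace ℝ (Fin N)) :=
    have : Nonempty (Fin N) := ⟨⟨0, hN⟩⟩
    inferInstance
  obtain ⟨S, hS1, hS⟩ := LocalTb.exists_finite_directions (EuclideanSpace ℝ (Fin N))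
    (EuclideanSpace ℝ (Fin M)) hε
  set f : EuclideanSpace ℝ (Fin N) → ℝ × (Fin n → ℝ) → ℝ≥0∞ := fun v p =>
    (LocalTb.directionCone (EuclideanSpace ℝ (Fin M)) v ε).indicator (fun A => ‖A‖ₑ ^ 2) (γ p)
    with hfdef
  -- The cone is closed, hence measurable; measurability is needed to exchange the finite sum with
  -- the integral.
  have hfm : ∀ v, AEMeasurable (f v) (LocalTb.halfSpaceMeasure μ) := fun v =>
    ((measurable_enorm.pow_const 2).indicator
      (LocalTb.isClosed_directionCone v ε).measurableSet).comp_aemeasurable hγ.aemeasurable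
  have hdir : ∀ v, ∃ Λ : ℝ≥0, v ∈ S → ∀ k m,
      ∫⁻ p in LocalTb.carlesonBox k m, f v p ∂(LocalTb.halfSpaceMeasure μ) ≤
        Λ * μ (LocalTb.dyadicCube k m) := by
    intro v
    by_cases hv : v ∈ S
    · obtain ⟨Λ, hΛ⟩ := LocalTb.exists_lintegral_strip_le hμ hA h0 (LocalTb.halfSpaceMeasure μ) γ
        hK le_rfl le_rfl hε hεs hτ hτ1 hτε.le (hS1 v hv) (fun k m => hb k m v (hS1 v hv)) (f v)
        fun p e h1 h2 => by
          refine Set.indicator_apply_le' (fun h => ?_) fun _ => zero_le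
          exact LocalTb.enorm_sq_le_of_mem_directionCone h h1 h2
      exact ⟨Λ, fun _ k m => LocalTb.lintegral_carlesonBox_le _ _ k m fun j => hΛ j k m⟩
    · exact ⟨0, fun h => absurd h hv⟩
  choose Λ hΛ using hdir
  refine lt_of_le_of_lt (iSup_le fun k => iSup_le fun m => ?_)
    (ENNReal.coe_lt_top (r := ∑ v ∈ S, Λ v))
  rw [mul_comm, ← div_eq_mul_inv]
  refine ENNReal.div_le_of_le_mul ?_
  calc ∫⁻ p in LocalTb.carlesonBox k m, ‖γ p‖ₑ ^ 2 ∂(LocalTb.halfSpaceMeasure μ)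
      ≤ ∫⁻ p in LocalTb.carlesonBox k m, ∑ v ∈ S, f v p ∂(LocalTb.halfSpaceMeasure μ) := by
        refine lintegral_mono fun p => ?_
        obtain ⟨v, hv, hp⟩ := hS (γ p)
        refine le_trans (le_of_eq ?_) (Finset.single_le_sum (fun _ _ => zero_le) hv)
        exact (Set.indicator_of_mem hp fun A => ‖A‖ₑ ^ 2).symm
    _ = ∑ v ∈ S, ∫⁻ p in LocalTb.carlesonBox k m, f v p ∂(LocalTb.halfSpaceMeasure μ) :=
        lintegral_finsetSum' _ fun v _ => (hfm v).restrict
    _ ≤ ∑ v ∈ S, (Λ v : ℝ≥0∞) * μ (LocalTb.dyadicCube k m) :=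
        Finset.sum_le_sum fun v hv => hΛ v hv k m
    _ = _ := by rw [← Finset.sum_mul]; push_cast; rfl
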